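/- **Model.** Consider $n\ge 2$ nodes forming a single-hop synchronous radio network (a complete graph) with collision detection. All nodes start in the same slot, and none knows $n$. In each slot a node broadcasts a message, listens, or stays idle; only a listening node gets feedback: silence if no other node broadcasts, the message if exactly one does, and noise if at least two do. All random choices, of all nodes and in all slots, are independent. Write $\lg=\log_2$. **Algorithm** CountSHCDHigh, with integer parameter $a$; every node executes the same two stages. *Stage 1 (upper bound).* For $i=1,2,\dots$ perform an iteration of two slots. In the first slot, each node broadcasts a beacon with probability $2^{-2^i}$ and listens otherwise. A node that listened and heard silence or a beacon broadcasts a stop message in the second slot and ends Stage 1; a node that listened and heard noise stays idle in the second slot; a node that broadcast listens in the second slot, and ends Stage 1 if it then hears a message or noise. A node that ends Stage 1 in iteration $i$ sets $\hat N=2^{2^{i+1}}$; the others continue with iteration $i+1$. *Stage 2 (random walk).* Each node sets $\hat n=\hat N$ and performs $a\lg\hat N$ iterations of three slots. In the first slot it broadcasts a beacon with probability $\min\{1/\hat n,1\}$ and listens otherwise. The nodes that listened and heard noise broadcast in the second slot, those that listened and heard a beacon broadcast in the third slot, and the nodes that broadcast in the first slot listen in both the second and the third. A node that listened in the first slot replaces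 $\hat n$ by $\hat n/4$ if it heard silence, by $4\hat n$ if it heard noise, and keeps $\hat n$ if it heard a beacon. A node that broadcast in the first slot replaces $\hat n$ by $4\hat n$ if the second slot was not silent; otherwise it keeps $\hat n$ if the third slot was not silent, and replaces $\hat n$ by $4\hat n$ if both were silent (then all nodes broadcast in the first slot). After the last iteration the node terminates with the final estimate $4\tilde n$, where $\tilde n$ is a most frequent value among the values of $\hat n$ used in the iterations; ties are broken by an arbitrary fixed rule, the same for all nodes. **Theorem.** There are constants $\gamma\ge 1$ and $a_0$ such that for every integer $a\ge a_0$ there is a constant $C$ (depending only on $a$) such that for every $n\ge 2$ and every tie-breaking rule: (a) all nodes terminate simultaneously: in every execution that has positive probability up to slot $t$, after slot $t$ either all nodes or no node have terminated; and with probability $1$ all nodes eventually terminate; (b) with probability at least $1-n^{-\gamma}$, within $C\lg n$ slots all nodes have terminated with the same final estimate, and this estimate lies in $[n,64n]$. -/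

import Mathlib

open Filter Topology
open scoped NNReal ENNReal NNRat

namespace RadioNetwork

/-! ### Synchronous radio networks with collision detection -/

/-- What a node does in one time slot. -/
inductive Action (M : Type) : Type where
  | broadcast (m : M)
  | listen
  | idle

/-- The message a node puts on the channel in a slot, if any. -/
def Action.sent {M : Type} : Action M → Option M
  | .broadcast m => some m
  | .listen => none
  | .idle => none

/-- What a node learns from the channel in one time slot. A node that does not listen gets
`nothing`. -/
inductive Reception (M : Type) : Type where
  | nothing
  | silence
  | message (m : M)
  | noise

/-- The messages broadcast in a slot by the neighbours of `u`, with multiplicity. -/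
def arriving {V M : Type*} [Fintype V] (G : SimpleGraph V) [DecidableRel G.Adj]
    (act : V → Option M) (u : V) : Multiset M :=
  (Finset.univ.filter fun v => G.Adj u v).val.filterMap act

open Classical in
/-- The feedback of the channel with collision detection: a listening node hears silence, a
message or noise according to whether no, exactly one, or at least two of its neighbours
broadcast. -/
noncomputable def receive {V : Type*} {M : Type} [Fintype V] (G : SimpleGraph V)
    [DecidableRel G.Adj] (act : V → Action M) (u : V) : Reception M :=
  match act u with
  | .broadcast _ => .nothing
  | .idle => .nothing
  | .listen =>
    if arriving G (fun v => (act v).sent) u = 0 then .silence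
    else if h : ∃ m, arriving G (fun v => (act v).sent) u = {m} then .message h.choose
    else .noise

/-- A randomized protocol, executed identically at every node. In each slot the node flips a coin
that shows heads (`true`) with probability `min (bias s) 1`, where `s` is its current state; the
state and the coin determine what it does; the state, the coin and what it hears determine its
next state. -/
structure Protocol (σ M : Type) where
  start : σ
  bias : σ → ℝ≥0
  action : σ → Bool → Action M
  next : σ → Bool → Reception M → σ

/-- A coin showing heads with probability `min p 1`. -/
noncomputable def flip (p : ℝ≥0) : PMF Bool :=
  PMF.ofFintype (fun b => ((cond b (min p 1) (1 - min p 1) : ℝ≥0) : ℝ≥0∞)) (by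
    rw [Fintype.sum_bool, cond_true, cond_false, ← ENNReal.coe_add,
      add_tsub_cancel_of_le (min_le_right p 1), ENNReal.coe_one])

/-- Independent coins, one for each node, that of `v` showing heads with probability
`min (p v) 1`. -/
noncomputable def flips {V : Type*} [Fintype V] [DecidableEq V] (p : V → ℝ≥0) :
    PMF (V → Bool) :=
  PMF.ofFintype (fun c => ∏ v, flip (p v) (c v)) (by
    rw [← Fintype.prod_sum (fun v b => flip (p v) b)]
    exact Finset.prod_eq_one fun v _ => by
      rw [← tsum_fintype (L := .unconditional _)]; exact (flip (p v)).tsum_coe)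

/-- The configuration after one more slot, as a function of the coins. -/
noncomputable def Protocol.advance {σ M : Type} (P : Protocol σ M) {V : Type*} [Fintype V]
    (G : SimpleGraph V) [DecidableRel G.Adj] (cfg : V → σ) (c : V → Bool) : V → σ :=
  fun u => P.next (cfg u) (c u) (receive G (fun v => P.action (cfg v) (c v)) u)

/-- The distribution of the configuration after `t` slots; all nodes start in the same slot, and
fresh independent coins are used in every slot. -/
noncomputable def Protocol.run {σ M : Type} (P : Protocol σ M) {V : Type*} [Fintype V]
    [DecidableEq V] (G : SimpleGraph V) [DecidableRel G.Adj] : ℕ → PMF (V → σ)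
  | 0 => PMF.pure fun _ => P.start
  | t + 1 => (P.run G t).bind fun cfg =>
      (flips fun v => P.bias (cfg v)).map (P.advance G cfg)

/-- `mode` returns a most frequent entry of every nonempty list (ties broken in any way). -/
def IsMostFrequent (mode : List ℚ≥0 → ℚ≥0) : Prop :=
  ∀ l : List ℚ≥0, l ≠ [] → mode l ∈ l ∧ ∀ x, l.count x ≤ l.count (mode l)

namespace CountSHCDHigh

/-- The messages used by the algorithm. -/
inductive Msg : Type where
  | beacon
  | halt
  | underEst
  | keep

/-- The local states of a node. In the walk, `L` is the estimate of `lg n` returned by the search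
for an upper bound, `used` lists the estimates of `n` used in the completed iterations, `e` is the
current estimate, and `r₁`, `r₂` are the receptions in the first and second slot of the current
iteration. -/
inductive State : Type where
  /-- first slot of iteration `i` of the search for an upper bound -/
  | search (i : ℕ)
  /-- second slot of iteration `i` of that search, after reception `r₁` in the first -/
  | confirm (i : ℕ) (r₁ : Reception Msg)
  /-- first slot of an iteration of the walk -/
  | walk₁ (L : ℕ) (used : List ℚ≥0) (e : ℚ≥0)
  /-- second slot of an iteration of the walk -/
  | walk₂ (L : ℕ) (used : List ℚ≥0) (e : ℚ≥0) (r₁ : Reception Msg)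
  /-- third slot of an iteration of the walk -/
  | walk₃ (L : ℕ) (used : List ℚ≥0) (e : ℚ≥0) (r₁ r₂ : Reception Msg)
  /-- the node has terminated with final estimate `e` -/
  | done (e : ℚ≥0)

/-- The final estimate of a node; `none` as long as the node has not terminated. -/
def State.output : State → Option ℚ≥0
  | .done e => some e
  | _ => none

/-- The probability of broadcasting a beacon. -/
noncomputable def bias : State → ℝ≥0
  | .search i => 1 / 2 ^ 2 ^ i
  | .walk₁ _ _ e => 1 / (e : ℝ≥0)
  | _ => 0

/-- Beacons are broadcast in first slots. In the second slot of an iteration of the search, the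
listeners that heard silence or a beacon broadcast `halt`, and the nodes that had broadcast
listen. In an iteration of the walk, the nodes that listened in the first slot and heard noise
broadcast in the second slot, those that heard a beacon broadcast in the third slot, and the nodes
that had broadcast listen in both. -/
def action : State → Bool → Action Msg
  | .search _, c => if c then .broadcast .beacon else .listen
  | .confirm _ .nothing, _ => .listen
  | .confirm _ .silence, _ => .broadcast .halt
  | .confirm _ (.message _), _ => .broadcast .halt
  | .confirm _ .noise, _ => .idle
  | .walk₁ _ _ _, c => if c then .broadcast .beacon else .listen
  | .walk₂ _ _ _ .nothing, _ => .listen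
  | .walk₂ _ _ _ .noise, _ => .broadcast .underEst
  | .walk₂ _ _ _ _, _ => .idle
  | .walk₃ _ _ _ .nothing _, _ => .listen
  | .walk₃ _ _ _ (.message _) _, _ => .broadcast .keep
  | .walk₃ _ _ _ _ _, _ => .idle
  | .done _, _ => .idle

/-- After iteration `i` of the search: end with the estimate `L = 2 ^ (i + 1)` of `lg n` and start
the walk at the upper bound `2 ^ L`, or go on with the next iteration. Here `r₁` and `r₂` are the
receptions in the two slots. -/
def endSearch (i : ℕ) (r₁ r₂ : Reception Msg) : State :=
  match r₁, r₂ with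
  | .silence, _ => .walk₁ (2 ^ (i + 1)) [] (2 ^ 2 ^ (i + 1))
  | .message _, _ => .walk₁ (2 ^ (i + 1)) [] (2 ^ 2 ^ (i + 1))
  | .nothing, .noise => .walk₁ (2 ^ (i + 1)) [] (2 ^ 2 ^ (i + 1))
  | .nothing, .message _ => .walk₁ (2 ^ (i + 1)) [] (2 ^ 2 ^ (i + 1))
  | _, _ => .search (i + 1)

/-- The estimate for the next iteration, from the receptions in the three slots of this one. The
last four lines concern a node that broadcast in the first slot: if it is helped in the second
slot, then the first slot was noisy; otherwise, if it is helped in the third slot, it broadcast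
alone; if it is helped in neither, no node listened in the first slot, so that (there being at
least two nodes) the first slot was noisy. -/
def newEstimate (e : ℚ≥0) : Reception Msg → Reception Msg → Reception Msg → ℚ≥0
  | .silence, _, _ => e / 4
  | .message _, _, _ => e
  | .noise, _, _ => 4 * e
  | .nothing, .message _, _ => 4 * e
  | .nothing, .noise, _ => 4 * e
  | .nothing, _, .silence => 4 * e
  | .nothing, _, _ => e

/-- End of an iteration of the walk: after `a * L` iterations, that is, `a * lg (2 ^ L)` where
`2 ^ L` is the upper bound on `n`, the node terminates with four times the most frequent
estimate. -/
def endIteration (a : ℕ) (mode : List ℚ≥0 → ℚ≥0) (L : ℕ) (used : List ℚ≥0) (e e' : ℚ≥0) : State :=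
  if a * L ≤ used.length + 1 then .done (4 * mode (used ++ [e]))
  else .walk₁ L (used ++ [e]) e'

def next (a : ℕ) (mode : List ℚ≥0 → ℚ≥0) : State → Reception Msg → State
  | .search i, r => .confirm i r
  | .confirm i r₁, r => endSearch i r₁ r
  | .walk₁ L used e, r => .walk₂ L used e r
  | .walk₂ L used e r₁, r => .walk₃ L used e r₁ r
  | .walk₃ L used e r₁ r₂, r => endIteration a mode L used e (newEstimate e r₁ r₂ r)
  | .done e, _ => .done e

end CountSHCDHigh

/-- The algorithm: a search for a polynomial upper bound `N` on the number of nodes, followed by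
`a * lg N` iterations (three slots each) of a random walk on estimates that starts at `N`. -/
noncomputable def countSHCDHigh (a : ℕ) (mode : List ℚ≥0 → ℚ≥0) :
    Protocol CountSHCDHigh.State CountSHCDHigh.Msg where
  start := .search 1
  bias := CountSHCDHigh.bias
  action := CountSHCDHigh.action
  next := fun s _ r => CountSHCDHigh.next a mode s r

end RadioNetwork

/-! The helper slots tell the broadcasters of the first slot what they missed, so after every
iteration all nodes share one state. The execution is thus a Markov chain on common states, driven
only by whether none, one or at least two of `n` equally biased coins show heads. This synchrony
gives simultaneous termination (`InStep.advance`) and the recursions `prob_search` and `prob_walk`.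

For the walk, let `m` be the integer part of `log₄ n` and measure an estimate `4 ^ j` by `d = j -
m`. Four times the mode is accurate when `d` is 0, 1 or 2. Visits are charged by `cost` so that a
bad mode forces a nonnegative total cost (`two_mul_count_le_sum_cost`). Total cost plus `potential`
drifts down by at least 7/100 per iteration with steps of size at most 5 (`expected_step_le`,
`abs_step_le`), so its exponential moment contracts by a fixed factor (`exp_three_step`). An
exponential Markov bound, run as a backward induction, makes failure exponentially small in `a * L`
(`prob_walk_ge`); a large `a` outweighs the initial potential, which is linear in `L` once the upper
bound is polynomially related to `n`.

The search can hurt in two ways. Stopping while the bound is far too low has probability at most `1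
/ (4 n²)` per iteration (`one_sub_searchNoise_le`), and noise once `2 ^ 2 ^ i ≥ n ^ 2` has
probability at most `1 / (4 n)`. With the walk's own `1 / (4 n)`, the failures stay below `1 / n`.
-/

namespace RadioNetwork

/-! ### Markov property of the execution: first-slot analysis. -/

section Run

variable {σ M : Type} (P : Protocol σ M) {V : Type*} [Fintype V] [DecidableEq V]
  (G : SimpleGraph V) [DecidableRel G.Adj]

/-- The distribution of the configuration `t` slots after the configuration `cfg`. -/
noncomputable def Protocol.runFrom (cfg : V → σ) : ℕ → PMF (V → σ)
  | 0 => PMF.pure cfg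
  | t + 1 => (Protocol.runFrom cfg t).bind fun cfg' =>
      (flips fun v => P.bias (cfg' v)).map (P.advance G cfg')

theorem Protocol.run_eq_runFrom (t : ℕ) :
    P.run G t = P.runFrom G (fun _ => P.start) t := by
  induction t with
  | zero => rfl
  | succ t ih => rw [Protocol.run, Protocol.runFrom, ih]

/-- The recursion in `runFrom` splits off the last slot; splitting off the first one instead allows
induction on the remaining time. -/
theorem Protocol.runFrom_succ (cfg : V → σ) (t : ℕ) :
    P.runFrom G cfg (t + 1) =
      (flips fun v => P.bias (cfg v)).bind fun c => P.runFrom G (P.advance G cfg c) t := by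
  induction t with
  | zero =>
    simp only [Protocol.runFrom, PMF.pure_bind]
    rfl
  | succ t ih =>
    rw [Protocol.runFrom, ih, PMF.bind_bind]
    rfl

/-- The probability that the configuration lies in `S`, `t` slots after the configuration `cfg`. -/
noncomputable def Protocol.probFrom (S : Set (V → σ)) (cfg : V → σ) (t : ℕ) : ℝ :=
  ((P.runFrom G cfg t).toOuterMeasure S).toReal

theorem _root_.PMF.toOuterMeasure_apply_le_one {α : Type*} (p : PMF α) (S : Set α) :
    p.toOuterMeasure S ≤ 1 := by
  rw [PMF.toOuterMeasure_apply, ← p.tsum_coe]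
  exact ENNReal.tsum_le_tsum fun a => Set.indicator_le_self S p a

theorem _root_.PMF.toOuterMeasure_apply_ne_top {α : Type*} (p : PMF α) (S : Set α) :
    p.toOuterMeasure S ≠ ∞ :=
  ne_top_of_le_ne_top ENNReal.one_ne_top (p.toOuterMeasure_apply_le_one S)

theorem _root_.PMF.sum_toReal {α : Type*} [Fintype α] (p : PMF α) : ∑ a, (p a).toReal = 1 := by
  rw [← ENNReal.toReal_sum fun a _ => p.apply_ne_top a, ← tsum_fintype (L := .unconditional _),
    p.tsum_coe, ENNReal.toReal_one]

theorem Protocol.probFrom_nonneg (S : Set (V → σ)) (cfg : V → σ) (t : ℕ) :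
    0 ≤ P.probFrom G S cfg t := ENNReal.toReal_nonneg

theorem Protocol.probFrom_le_one (S : Set (V → σ)) (cfg : V → σ) (t : ℕ) :
    P.probFrom G S cfg t ≤ 1 :=
  ENNReal.toReal_le_of_le_ofReal zero_le_one
    (by rw [ENNReal.ofReal_one]; exact PMF.toOuterMeasure_apply_le_one _ _)

theorem Protocol.probFrom_zero (S : Set (V → σ)) (cfg : V → σ) (h : cfg ∈ S) :
    P.probFrom G S cfg 0 = 1 := by
  classical
  simp [Protocol.probFrom, Protocol.runFrom, h]

theorem Protocol.probFrom_succ (S : Set (V → σ)) (cfg : V → σ) (t : ℕ) :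
    P.probFrom G S cfg (t + 1) =
      ∑ c, (flips (fun v => P.bias (cfg v)) c).toReal *
        P.probFrom G S (P.advance G cfg c) t := by
  rw [Protocol.probFrom, Protocol.runFrom_succ, PMF.toOuterMeasure_bind_apply, tsum_fintype,
    ENNReal.toReal_sum]
  · simp only [ENNReal.toReal_mul, Protocol.probFrom]
  · exact fun c _ => ENNReal.mul_ne_top (PMF.apply_ne_top _ _) (PMF.toOuterMeasure_apply_ne_top _ _)

/-- A slot whose outcome does not depend on the coins. -/
theorem Protocol.probFrom_succ_of_forall (S : Set (V → σ)) (cfg cfg' : V → σ) (t : ℕ)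
    (h : ∀ c, P.advance G cfg c = cfg') :
    P.probFrom G S cfg (t + 1) = P.probFrom G S cfg' t := by
  simp only [Protocol.probFrom_succ, h, ← Finset.sum_mul, PMF.sum_toReal, one_mul]

theorem Protocol.exists_of_mem_support_run_succ {t : ℕ} {cfg : V → σ}
    (h : cfg ∈ (P.run G (t + 1)).support) :
    ∃ cfg' ∈ (P.run G t).support, ∃ c, cfg = P.advance G cfg' c := by
  simp only [Protocol.run, PMF.mem_support_bind_iff, PMF.mem_support_map_iff] at h
  obtain ⟨cfg', h', c, -, rfl⟩ := h
  exact ⟨cfg', h', c, rfl⟩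

end Run

/-! ### Independent coins with a common bias: none, one or several heads. -/

section Coins

variable {V : Type*} [Fintype V]

/-- The nodes whose coins show heads. -/
def heads (c : V → Bool) : Finset V := Finset.univ.filter fun v => c v = true

theorem mem_heads {c : V → Bool} {v : V} : v ∈ heads c ↔ c v = true := by simp [heads]

theorem flips_const_toReal [DecidableEq V] (p : ℝ≥0) (c : V → Bool) :
    (flips (fun _ => p) c).toReal =
      ((min p 1 : ℝ≥0) : ℝ) ^ (heads c).card *
        (1 - ((min p 1 : ℝ≥0) : ℝ)) ^ (Fintype.card V - (heads c).card) := by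
  have h (b : Bool) : (flip p b).toReal =
      if b = true then ((min p 1 : ℝ≥0) : ℝ) else 1 - ((min p 1 : ℝ≥0) : ℝ) := by
    cases b
    · simp only [flip, PMF.ofFintype_apply, cond_false, ENNReal.coe_toReal]
      rw [NNReal.coe_sub (min_le_right p 1)]
      simp
    · simp only [flip, PMF.ofFintype_apply, cond_true, ENNReal.coe_toReal, if_true]
  simp only [flips, PMF.ofFintype_apply, ENNReal.toReal_prod, h]
  rw [Finset.prod_ite, Finset.prod_const, Finset.prod_const]
  congr 2
  have := Finset.card_filter_add_card_filter_not (s := (Finset.univ : Finset V))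
    (fun v => c v = true)
  rw [Finset.card_univ] at this
  simp only [heads]
  omega

theorem sum_flips_mul_card_heads [DecidableEq V] (p : ℝ≥0) (f : ℕ → ℝ) :
    ∑ c : V → Bool, (flips (fun _ => p) c).toReal * f (heads c).card =
      ∑ k ∈ Finset.range (Fintype.card V + 1), (Fintype.card V).choose k *
        (((min p 1 : ℝ≥0) : ℝ) ^ k * (1 - ((min p 1 : ℝ≥0) : ℝ)) ^ (Fintype.card V - k) * f k) := by
  simp only [flips_const_toReal]
  set q : ℝ := ((min p 1 : ℝ≥0) : ℝ)
  have := Finset.sum_powerset_apply_card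
    (fun k => q ^ k * (1 - q) ^ (Fintype.card V - k) * f k) (x := (Finset.univ : Finset V))
  simp only [nsmul_eq_mul, Finset.card_univ] at this
  rw [← this]
  refine Finset.sum_nbij' heads (fun s v => decide (v ∈ s)) ?_ ?_ ?_ ?_ ?_
  · simp
  · simp
  · intro c _
    ext v
    simp [mem_heads]
  · intro s _
    ext v
    simp [mem_heads]
  · simp

/-- The probability that none of `n` coins with bias `q` shows heads. -/
def noHeads (n : ℕ) (q : ℝ) : ℝ := (1 - q) ^ n

/-- The probability that exactly one of `n` coins with bias `q` shows heads. -/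
def oneHead (n : ℕ) (q : ℝ) : ℝ := n * q * (1 - q) ^ (n - 1)

/-- The probability that at least two of `n` coins with bias `q` show heads. -/
def manyHeads (n : ℕ) (q : ℝ) : ℝ := 1 - noHeads n q - oneHead n q

theorem sum_flips_mul [DecidableEq V] (hV : 2 ≤ Fintype.card V) (p : ℝ≥0) (A B C : ℝ) :
    ∑ c : V → Bool, (flips (fun _ => p) c).toReal *
        (if (heads c).card = 0 then A else if (heads c).card = 1 then B else C) =
      noHeads (Fintype.card V) (min p 1 : ℝ≥0) * A + oneHead (Fintype.card V) (min p 1 : ℝ≥0) * B +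
        manyHeads (Fintype.card V) (min p 1 : ℝ≥0) * C := by
  rw [sum_flips_mul_card_heads p fun k => if k = 0 then A else if k = 1 then B else C]
  set q : ℝ := ((min p 1 : ℝ≥0) : ℝ)
  obtain ⟨n, hn⟩ := Nat.exists_eq_add_of_le' hV
  -- The binomial theorem for `q + (1 - q) = 1` identifies the terms with at least two heads as the
  -- complement of the first two terms.
  have h := add_pow q (1 - q) (Fintype.card V)
  rw [add_sub_cancel, one_pow, hn, Finset.sum_range_succ', Finset.sum_range_succ'] at h
  rw [hn, Finset.sum_range_succ', Finset.sum_range_succ']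
  simp only [manyHeads, noHeads, oneHead] at h ⊢
  have h2 : ∑ k ∈ Finset.range (n + 1), ((n + 2).choose (k + 1 + 1) : ℝ) *
      (q ^ (k + 1 + 1) * (1 - q) ^ (n + 2 - (k + 1 + 1)) *
        (if k + 1 + 1 = 0 then A else if k + 1 + 1 = 1 then B else C)) =
      (∑ k ∈ Finset.range (n + 1), q ^ (k + 1 + 1) * (1 - q) ^ (n + 2 - (k + 1 + 1)) *
        ((n + 2).choose (k + 1 + 1) : ℝ)) * C := by
    rw [Finset.sum_mul]
    refine Finset.sum_congr rfl fun k _ => ?_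
    rw [if_neg (by omega), if_neg (by omega)]
    ring
  rw [h2]
  simp only [zero_add, Nat.choose_one_right, Nat.choose_zero_right, pow_zero, pow_one, one_ne_zero,
    if_true, if_false, Nat.sub_zero, Nat.cast_one, one_mul, mul_one] at h ⊢
  linear_combination (-C) * h

theorem noHeads_nonneg (n : ℕ) {q : ℝ} (h1 : q ≤ 1) : 0 ≤ noHeads n q :=
  pow_nonneg (sub_nonneg.2 h1) n

theorem oneHead_nonneg (n : ℕ) {q : ℝ} (h0 : 0 ≤ q) (h1 : q ≤ 1) : 0 ≤ oneHead n q :=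
  mul_nonneg (by positivity) (pow_nonneg (sub_nonneg.2 h1) _)

/-- The upper bound is the union bound over pairs of coins, obtained here by adding one coin at a
time. -/
theorem manyHeads_mem (n : ℕ) {q : ℝ} (h0 : 0 ≤ q) (h1 : q ≤ 1) :
    0 ≤ manyHeads n q ∧ manyHeads n q ≤ (n * q) ^ 2 / 2 := by
  rcases n with _ | n
  · simp [manyHeads, noHeads, oneHead]
  suffices h : 0 ≤ manyHeads (n + 1) q ∧ manyHeads (n + 1) q ≤ n * (n + 1) * q ^ 2 / 2 by
    refine ⟨h.1, h.2.trans ?_⟩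
    push_cast
    have : 0 ≤ (n + 1 : ℝ) * q ^ 2 := by positivity
    linarith
  induction n with
  | zero => simp [manyHeads, noHeads, oneHead]
  | succ n ih =>
    -- The increment is the probability that the new coin shows the second head.
    have e : manyHeads (n + 1 + 1) q = manyHeads (n + 1) q + (n + 1) * q ^ 2 * (1 - q) ^ n := by
      simp only [manyHeads, noHeads, oneHead, Nat.add_sub_cancel]
      push_cast
      ring
    have h2 : 0 ≤ (1 - q) ^ n := pow_nonneg (sub_nonneg.2 h1) _
    have h3 : (1 - q) ^ n ≤ 1 := pow_le_one₀ (sub_nonneg.2 h1) (by linarith)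
    have h4 : 0 ≤ (n + 1) * q ^ 2 := by positivity
    have h5 := mul_le_mul_of_nonneg_left h3 h4
    rw [e]
    refine ⟨add_nonneg ih.1 (mul_nonneg h4 h2), ?_⟩
    push_cast
    linarith [ih.2]

end Coins

/-! ### Feedback on a complete graph. -/

section Channel

theorem receive_of_ne_listen {V : Type*} {M : Type} [Fintype V] (G : SimpleGraph V)
    [DecidableRel G.Adj] (act : V → Action M) (u : V) (hu : act u ≠ .listen) :
    receive G act u = .nothing := by
  rw [receive]
  split <;> first | rfl | (rename_i h; exact absurd h hu)

variable {V : Type*} [Fintype V] [DecidableEq V] {M : Type}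

/-- If the nodes in `S` send `m` and the others are silent, a listener hears silence, `m` or noise
according to the size of `S`. -/
theorem receive_top (act : V → Action M) (S : Finset V) (m : M)
    (h : ∀ v, (act v).sent = if v ∈ S then some m else none) (u : V) (hu : act u = .listen) :
    receive (⊤ : SimpleGraph V) act u =
      if S.card = 0 then .silence else if S.card = 1 then .message m else .noise := by
  -- A listener sends nothing, so all of `S` consists of its neighbours and no sender is missed.
  have huS : u ∉ S := fun hm => by simpa [hu, hm, Action.sent] using h u
  have key : ∀ s : Multiset V,
      s.filterMap (fun v => (act v).sent) = Multiset.replicate (s.filter (· ∈ S)).card m := by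
    intro s
    induction s using Multiset.induction with
    | empty => simp
    | cons v s ih =>
      by_cases hv : v ∈ S
      · rw [Multiset.filterMap_cons_some _ _ _ (by rw [h v, if_pos hv]), ih,
          Multiset.filter_cons_of_pos _ hv, Multiset.card_cons, Multiset.replicate_succ]
      · rw [Multiset.filterMap_cons_none _ _ (by rw [h v, if_neg hv]), ih,
          Multiset.filter_cons_of_neg _ hv]
  have harr : arriving (⊤ : SimpleGraph V) (fun v => (act v).sent) u =
      Multiset.replicate S.card m := by
    rw [arriving, key, ← Finset.filter_val, Finset.card_val, Finset.filter_filter]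
    congr 2
    ext v
    simp only [SimpleGraph.top_adj, Finset.mem_filter, Finset.mem_univ, true_and]
    exact ⟨fun h => h.2, fun h => ⟨fun e => huS (e ▸ h), h⟩⟩
  rw [receive, hu]
  generalize arriving (⊤ : SimpleGraph V) (fun v => (act v).sent) u = A at harr
  subst harr
  generalize S.card = k
  rcases k with _ | _ | k
  · simp
  · have hex : ∃ m', Multiset.replicate (0 + 1) m = {m'} := ⟨m, by simp⟩
    have := hex.choose_spec
    rw [if_neg (by simp), dif_pos hex, if_neg (by simp), if_pos rfl]
    simp only [zero_add, Multiset.replicate_one] at this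
    exact congrArg Reception.message (Multiset.singleton_inj.1 this).symm
  · rw [if_neg (by simp), dif_neg, if_neg (by simp), if_neg (by simp)]
    rintro ⟨m', hm'⟩
    simpa using congrArg Multiset.card hm'

end Channel

namespace CountSHCDHigh

/-! ### Synchrony: each iteration takes a common state to a common state. -/

section Slots

variable {V : Type*} [Fintype V]

theorem card_heads_pos {c : V → Bool} {u : V} (h : c u = true) : 0 < (heads c).card :=
  Finset.card_pos.2 ⟨u, mem_heads.2 h⟩

/-- What a node hears in a slot in which the nodes whose coins show heads broadcast beacons and the
others listen. -/
def firstReception (c : V → Bool) (u : V) : Reception Msg :=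
  if c u = true then .nothing
  else if (heads c).card = 0 then .silence
  else if (heads c).card = 1 then .message .beacon
  else .noise

/-- What a node hears in the second slot of an iteration of the walk. -/
def secondReception [DecidableEq V] (c : V → Bool) (u : V) : Reception Msg :=
  if c u = true then
    if 2 ≤ (heads c).card then
      if (heads c)ᶜ.card = 0 then .silence
      else if (heads c)ᶜ.card = 1 then .message .underEst
      else .noise
    else .silence
  else .nothing

/-- The common estimate after an iteration of the walk. -/
def updatedEstimate (e : ℚ≥0) (c : V → Bool) : ℚ≥0 :=
  if (heads c).card = 0 then e / 4 else if (heads c).card = 1 then e else 4 * e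

/-- The common state after an iteration of the search. -/
def searchOutcome (i : ℕ) (c : V → Bool) : State :=
  if (heads c).card ≤ 1 then .walk₁ (2 ^ (i + 1)) [] (2 ^ 2 ^ (i + 1)) else .search (i + 1)

variable [DecidableEq V]

theorem receive_beacons (c : V → Bool) (u : V) :
    receive (⊤ : SimpleGraph V)
      (fun v => if c v = true then Action.broadcast Msg.beacon else Action.listen) u =
      firstReception c u := by
  by_cases hu : c u = true
  · rw [receive_of_ne_listen _ _ _ (by simp [hu]), firstReception, if_pos hu]
  · rw [receive_top _ (heads c) Msg.beacon, firstReception, if_neg hu]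
    · intro v
      by_cases hv : c v = true <;> simp [hv, mem_heads, Action.sent]
    · simp [hu]

variable (a : ℕ) (mode : List ℚ≥0 → ℚ≥0)

theorem advance_search (i : ℕ) (c : V → Bool) :
    (countSHCDHigh a mode).advance (⊤ : SimpleGraph V) (fun _ => .search i) c =
      fun u => .confirm i (firstReception c u) := by
  funext u
  exact congrArg (State.confirm i) (receive_beacons c u)

theorem advance_walk₁ (L : ℕ) (used : List ℚ≥0) (e : ℚ≥0) (c : V → Bool) :
    (countSHCDHigh a mode).advance (⊤ : SimpleGraph V) (fun _ => .walk₁ L used e) c =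
      fun u => .walk₂ L used e (firstReception c u) := by
  funext u
  exact congrArg (State.walk₂ L used e) (receive_beacons c u)

theorem card_compl_heads (c : V → Bool) :
    (heads c)ᶜ.card = Fintype.card V - (heads c).card := Finset.card_compl _

/-- Listeners know the outcome already. A lone broadcaster learns it because, with at least two
nodes, some listener sends `halt`; if several nodes broadcast, nobody sends `halt`. -/
theorem advance_confirm (hV : 2 ≤ Fintype.card V) (i : ℕ) (c c' : V → Bool) :
    (countSHCDHigh a mode).advance (⊤ : SimpleGraph V)
      (fun u => .confirm i (firstReception c u)) c' = fun _ => searchOutcome i c := by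
  funext u
  change endSearch i (firstReception c u) (receive (⊤ : SimpleGraph V)
    (fun v => action (.confirm i (firstReception c v)) (c' v)) u) = searchOutcome i c
  by_cases hu : c u = true
  · have hpos := card_heads_pos hu
    rw [receive_top _ (if (heads c).card ≤ 1 then (heads c)ᶜ else ∅) Msg.halt]
    · by_cases hk : (heads c).card ≤ 1
      · have hc : (heads c)ᶜ.card ≠ 0 := by rw [card_compl_heads]; omega
        simp only [firstReception, searchOutcome, hu, hk, hc, if_true, if_false]
        split_ifs <;> rfl
      · simp only [firstReception, searchOutcome, hu, hk, if_true, if_false, Finset.card_empty]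
        rfl
    · intro v
      by_cases hv : c v = true
      · have : v ∉ (if (heads c).card ≤ 1 then (heads c)ᶜ else ∅) := by
          split_ifs <;> simp [mem_heads, hv]
        rw [if_neg this]
        simp [firstReception, hv, action, Action.sent]
      · rcases hk : (heads c).card with _ | _ | k <;>
          simp [firstReception, hv, hk, action, Action.sent, mem_heads]
    · simp [firstReception, hu, action]
  · rcases hk : (heads c).card with _ | _ | k <;>
      simp [firstReception, searchOutcome, hu, hk, endSearch]

theorem advance_walk₂ (L : ℕ) (used : List ℚ≥0) (e : ℚ≥0) (c c' : V → Bool) :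
    (countSHCDHigh a mode).advance (⊤ : SimpleGraph V)
      (fun u => .walk₂ L used e (firstReception c u)) c' =
      fun u => .walk₃ L used e (firstReception c u) (secondReception c u) := by
  funext u
  change State.walk₃ L used e (firstReception c u) (receive (⊤ : SimpleGraph V)
    (fun v => action (.walk₂ L used e (firstReception c v)) (c' v)) u) = _
  congr 1
  by_cases hu : c u = true
  · rw [receive_top _ (if 2 ≤ (heads c).card then (heads c)ᶜ else ∅) Msg.underEst]
    · by_cases hk : 2 ≤ (heads c).card <;> simp [secondReception, hu, hk]
    · intro v
      by_cases hv : c v = true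
      · have : v ∉ (if 2 ≤ (heads c).card then (heads c)ᶜ else ∅) := by
          split_ifs <;> simp [mem_heads, hv]
        rw [if_neg this]
        simp [firstReception, hv, action, Action.sent]
      · rcases hk : (heads c).card with _ | _ | k <;>
          simp [firstReception, hv, hk, action, Action.sent, mem_heads]
    · simp [firstReception, hu, action]
  · rw [receive_of_ne_listen]
    · simp [secondReception, hu]
    · rcases hk : (heads c).card with _ | _ | k <;> simp [firstReception, hu, hk, action]

/-- A lone broadcaster hears `keep` from the listeners, who exist since there are two nodes. If
several broadcast, the third slot is silent, so they quadruple their estimate whether or not a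
listener helped in the second slot. -/
theorem advance_walk₃ (hV : 2 ≤ Fintype.card V) (L : ℕ) (used : List ℚ≥0) (e : ℚ≥0)
    (c c' : V → Bool) :
    (countSHCDHigh a mode).advance (⊤ : SimpleGraph V)
      (fun u => .walk₃ L used e (firstReception c u) (secondReception c u)) c' =
      fun _ => endIteration a mode L used e (updatedEstimate e c) := by
  funext u
  change endIteration a mode L used e (newEstimate e (firstReception c u) (secondReception c u)
    (receive (⊤ : SimpleGraph V) (fun v => action
      (.walk₃ L used e (firstReception c v) (secondReception c v)) (c' v)) u)) = _
  congr 1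
  by_cases hu : c u = true
  · have hpos := card_heads_pos hu
    rw [receive_top _ (if (heads c).card = 1 then (heads c)ᶜ else ∅) Msg.keep]
    · by_cases hk : (heads c).card = 1
      · have hc : (heads c)ᶜ.card ≠ 0 := by rw [card_compl_heads]; omega
        have h2 : ¬ 2 ≤ 1 := by decide
        simp only [firstReception, secondReception, updatedEstimate, hu, hk, hc, h2, one_ne_zero,
          if_true, if_false]
        split_ifs <;> rfl
      · have h0 : (heads c).card ≠ 0 := by omega
        have h2 : 2 ≤ (heads c).card := by omega
        simp only [firstReception, secondReception, updatedEstimate, hu, hk, h0, h2, if_true,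
          if_false, Finset.card_empty]
        split_ifs <;> rfl
    · intro v
      by_cases hv : c v = true
      · have : v ∉ (if (heads c).card = 1 then (heads c)ᶜ else ∅) := by
          split_ifs <;> simp [mem_heads, hv]
        rw [if_neg this]
        simp [firstReception, hv, action, Action.sent]
      · rcases hk : (heads c).card with _ | _ | k <;>
          simp [firstReception, hv, hk, action, Action.sent, mem_heads]
    · simp [firstReception, hu, action]
  · rcases hk : (heads c).card with _ | _ | k <;>
      simp [firstReception, updatedEstimate, hu, hk, newEstimate]

theorem advance_done (e : ℚ≥0) (c : V → Bool) :
    (countSHCDHigh a mode).advance (⊤ : SimpleGraph V) (fun _ => .done e) c = fun _ => .done e :=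
  rfl

/-- The configurations in which the nodes are in step with each other. -/
inductive InStep : (V → State) → Prop where
  | search (i : ℕ) : InStep fun _ => .search i
  | confirm (i : ℕ) (c : V → Bool) : InStep fun u => .confirm i (firstReception c u)
  | walk₁ (L : ℕ) (used : List ℚ≥0) (e : ℚ≥0) : InStep fun _ => .walk₁ L used e
  | walk₂ (L : ℕ) (used : List ℚ≥0) (e : ℚ≥0) (c : V → Bool) :
      InStep fun u => .walk₂ L used e (firstReception c u)
  | walk₃ (L : ℕ) (used : List ℚ≥0) (e : ℚ≥0) (c : V → Bool) :
      InStep fun u => .walk₃ L used e (firstReception c u) (secondReception c u)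
  | done (e : ℚ≥0) : InStep fun _ => .done e

theorem InStep.advance (hV : 2 ≤ Fintype.card V) {cfg : V → State} (h : InStep cfg)
    (c : V → Bool) : InStep ((countSHCDHigh a mode).advance (⊤ : SimpleGraph V) cfg c) := by
  cases h with
  | search i => rw [advance_search]; exact .confirm i c
  | confirm i c₁ =>
    rw [advance_confirm a mode hV, searchOutcome]
    split_ifs
    · exact .walk₁ _ _ _
    · exact .search _
  | walk₁ L used e => rw [advance_walk₁]; exact .walk₂ L used e c
  | walk₂ L used e c₁ => rw [advance_walk₂]; exact .walk₃ L used e c₁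
  | walk₃ L used e c₁ =>
    rw [advance_walk₃ a mode hV, endIteration]
    split_ifs
    · exact .done _
    · exact .walk₁ _ _ _
  | done e => rw [advance_done]; exact .done e

theorem inStep_of_mem_support_run (hV : 2 ≤ Fintype.card V) (t : ℕ) (cfg : V → State)
    (h : cfg ∈ ((countSHCDHigh a mode).run (⊤ : SimpleGraph V) t).support) : InStep cfg := by
  induction t generalizing cfg with
  | zero =>
    rw [Protocol.run, PMF.mem_support_pure_iff] at h
    rw [h]
    exact .search 1
  | succ t ih =>
    obtain ⟨cfg', h', c, rfl⟩ := Protocol.exists_of_mem_support_run_succ _ _ h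
    exact (ih cfg' h').advance a mode hV c

theorem InStep.output_isSome {cfg : V → State} (h : InStep cfg) (u v : V)
    (hu : (cfg u).output.isSome) : (cfg v).output.isSome := by
  cases h <;> simp_all [State.output]

/-- The probability that the configuration lies in `S`, `t` slots after all nodes were in state
`s`. -/
noncomputable def prob (S : Set (V → State)) (s : State) (t : ℕ) : ℝ :=
  (countSHCDHigh a mode).probFrom (⊤ : SimpleGraph V) S (fun _ => s) t

theorem prob_nonneg (S : Set (V → State)) (s : State) (t : ℕ) : 0 ≤ prob a mode S s t :=
  Protocol.probFrom_nonneg _ _ _ _ _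

theorem prob_le_one (S : Set (V → State)) (s : State) (t : ℕ) : prob a mode S s t ≤ 1 :=
  Protocol.probFrom_le_one _ _ _ _ _

theorem prob_search (hV : 2 ≤ Fintype.card V) (S : Set (V → State)) (i t : ℕ) :
    prob a mode S (.search i) (t + 2) =
      (1 - manyHeads (Fintype.card V) (min (1 / 2 ^ 2 ^ i) 1 : ℝ≥0)) *
        prob a mode S (.walk₁ (2 ^ (i + 1)) [] (2 ^ 2 ^ (i + 1))) t +
      manyHeads (Fintype.card V) (min (1 / 2 ^ 2 ^ i) 1 : ℝ≥0) *
        prob a mode S (.search (i + 1)) t := by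
  rw [prob, Protocol.probFrom_succ]
  have (c : V → Bool) : (countSHCDHigh a mode).probFrom (⊤ : SimpleGraph V) S
      ((countSHCDHigh a mode).advance (⊤ : SimpleGraph V) (fun _ => .search i) c) (t + 1) =
      if (heads c).card = 0 then prob a mode S (.walk₁ (2 ^ (i + 1)) [] (2 ^ 2 ^ (i + 1))) t
      else if (heads c).card = 1 then
        prob a mode S (.walk₁ (2 ^ (i + 1)) [] (2 ^ 2 ^ (i + 1))) t
      else prob a mode S (.search (i + 1)) t := by
    rw [advance_search, Protocol.probFrom_succ_of_forall _ _ _ _ _ _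
      (advance_confirm a mode hV i c)]
    rcases hk : (heads c).card with _ | _ | k <;> simp [searchOutcome, hk, prob]
  simp only [this]
  refine (sum_flips_mul hV _ _ _ _).trans ?_
  simp only [countSHCDHigh, bias, manyHeads]
  ring

/-- Only the coins of the first slot matter, so an iteration is a three-way step of the common
estimate. -/
theorem prob_walk (hV : 2 ≤ Fintype.card V) (S : Set (V → State)) (L : ℕ) (used : List ℚ≥0)
    (e : ℚ≥0) (t : ℕ) :
    prob a mode S (.walk₁ L used e) (t + 3) =
      noHeads (Fintype.card V) (min (1 / (e : ℝ≥0)) 1 : ℝ≥0) *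
        prob a mode S (endIteration a mode L used e (e / 4)) t +
      oneHead (Fintype.card V) (min (1 / (e : ℝ≥0)) 1 : ℝ≥0) *
        prob a mode S (endIteration a mode L used e e) t +
      manyHeads (Fintype.card V) (min (1 / (e : ℝ≥0)) 1 : ℝ≥0) *
        prob a mode S (endIteration a mode L used e (4 * e)) t := by
  rw [prob, Protocol.probFrom_succ]
  have (c : V → Bool) : (countSHCDHigh a mode).probFrom (⊤ : SimpleGraph V) S
      ((countSHCDHigh a mode).advance (⊤ : SimpleGraph V) (fun _ => .walk₁ L used e) c) (t + 2) =
      if (heads c).card = 0 then prob a mode S (endIteration a mode L used e (e / 4)) t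
      else if (heads c).card = 1 then prob a mode S (endIteration a mode L used e e) t
      else prob a mode S (endIteration a mode L used e (4 * e)) t := by
    rw [advance_walk₁, Protocol.probFrom_succ_of_forall _ _ _ _ _ _
      (advance_walk₂ a mode L used e c), Protocol.probFrom_succ_of_forall _ _ _ _ _ _
      (advance_walk₃ a mode hV L used e c)]
    rcases hk : (heads c).card with _ | _ | k <;> simp [updatedEstimate, hk, prob]
  simp only [this]
  exact sum_flips_mul hV _ _ _ _

theorem prob_done (S : Set (V → State)) (e : ℚ≥0) (h : (fun _ => .done e) ∈ S) (t : ℕ) :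
    prob a mode S (.done e) t = 1 := by
  induction t with
  | zero => exact Protocol.probFrom_zero _ _ _ _ h
  | succ t ih =>
    rw [prob, Protocol.probFrom_succ_of_forall _ _ _ _ _ _ (advance_done a mode e)]
    exact ih

end Slots

/-! ### The random walk on powers of four: drift and exponential moments. -/

section Walk

/-- The cost of a visit to the `d`-th power of four, counted from the largest one below the number
of nodes. When a bad value is most frequent, the total cost is nonnegative. -/
def cost (d : ℤ) : ℝ := if d = 0 ∨ d = 1 then -1 else if d = 2 then 0 else 2

/-- A potential for the walk, whose expected increase outweighs the cost. -/
noncomputable def potential (d : ℤ) : ℝ :=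
  if d ≤ 0 then -(5 / 2) * d else if d = 1 then 0 else 3 * d - 5

theorem potential_nonneg (d : ℤ) : 0 ≤ potential d := by
  rw [potential]
  split_ifs with h h1
  · have : (d : ℝ) ≤ 0 := by exact_mod_cast h
    linarith
  · exact le_rfl
  · have : (2 : ℝ) ≤ d := by exact_mod_cast (by omega : (2 : ℤ) ≤ d)
    linarith

theorem potential_le (d : ℤ) : potential d ≤ 3 * |(d : ℝ)| := by
  have h1 := le_abs_self (d : ℝ)
  have h2 := neg_abs_le (d : ℝ)
  have h3 := abs_nonneg (d : ℝ)
  rw [potential]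
  split_ifs <;> linarith

theorem potential_of_nonpos {d : ℤ} (h : d ≤ 0) : potential d = -(5 / 2) * d := if_pos h

theorem potential_of_two_le {d : ℤ} (h : 2 ≤ d) : potential d = 3 * d - 5 := by
  rw [potential, if_neg (by omega), if_neg (by omega)]

theorem cost_of_bad {d : ℤ} (h : d ≠ 0 ∧ d ≠ 1 ∧ d ≠ 2) : cost d = 2 := by
  simp [cost, h]

theorem abs_step_le (d d' : ℤ) (h : d' = d - 1 ∨ d' = d ∨ d' = d + 1) :
    |cost d + potential d' - potential d| ≤ 5 := by
  have hc : cost d ≤ 2 ∧ -1 ≤ cost d := by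
    rw [cost]
    split_ifs <;> norm_num
  have hp : |potential d' - potential d| ≤ 3 := by
    rcases h with rfl | rfl | rfl
    · rcases le_or_gt d 0 with h0 | h0
      · rw [potential_of_nonpos h0, potential_of_nonpos (by omega), abs_le]
        push_cast
        constructor <;> linarith
      · rcases (by omega : d = 1 ∨ d = 2 ∨ 3 ≤ d) with rfl | rfl | h3
        · norm_num [potential]
        · norm_num [potential]
        · rw [potential_of_two_le (by omega), potential_of_two_le (by omega), abs_le]
          push_cast
          constructor <;> linarith
    · simp
    · rcases (by omega : d ≤ -1 ∨ d = 0 ∨ d = 1 ∨ 2 ≤ d) with h0 | rfl | rfl | h3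
      · rw [potential_of_nonpos (by omega), potential_of_nonpos (by omega), abs_le]
        push_cast
        constructor <;> linarith
      · norm_num [potential]
      · norm_num [potential]
      · rw [potential_of_two_le (by omega), potential_of_two_le (by omega), abs_le]
        push_cast
        constructor <;> linarith
  rw [abs_le] at hp ⊢
  constructor <;> linarith

/-- By second-order expansion at parameter 1/1000, the drift gains `7 / 100000` and the quadratic
term loses at most `25 / 1000000`; the difference exceeds `1 / 25000`. -/
theorem exp_three_step {Q₀ Q₁ Q₂ x y z : ℝ} (h₀ : 0 ≤ Q₀) (h₁ : 0 ≤ Q₁) (h₂ : 0 ≤ Q₂)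
    (hQ : Q₀ + Q₁ + Q₂ = 1) (hx : |x| ≤ 5) (hy : |y| ≤ 5) (hz : |z| ≤ 5)
    (h : Q₀ * x + Q₁ * y + Q₂ * z ≤ -(7 / 100)) :
    Q₀ * Real.exp (x / 1000) + Q₁ * Real.exp (y / 1000) + Q₂ * Real.exp (z / 1000) ≤
      1 - 1 / 25000 := by
  have key {u : ℝ} (hu : |u| ≤ 5) : Real.exp (u / 1000) ≤ 1 + u / 1000 + 25 / 1000000 := by
    have h1 : |u / 1000| ≤ 1 := by
      rw [abs_div, abs_of_pos (by norm_num : (0 : ℝ) < 1000)]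
      linarith
    have h2 := (abs_le.1 (Real.abs_exp_sub_one_sub_id_le h1)).2
    have h3 := sq_le_sq' (abs_le.1 hu).1 (abs_le.1 hu).2
    have h4 : (u / 1000) ^ 2 = u ^ 2 / 1000000 := by ring
    rw [h4] at h2
    linarith
  have e0 := mul_le_mul_of_nonneg_left (key hx) h₀
  have e1 := mul_le_mul_of_nonneg_left (key hy) h₁
  have e2 := mul_le_mul_of_nonneg_left (key hz) h₂
  linarith

theorem noHeads_le_exp (n : ℕ) {q : ℝ} (h1 : q ≤ 1) : noHeads n q ≤ Real.exp (-(n * q)) := by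
  have h := pow_le_pow_left₀ (sub_nonneg.2 h1) (Real.one_sub_le_exp_neg q) n
  rw [← Real.exp_nat_mul] at h
  rwa [noHeads, ← mul_neg]

theorem one_sub_le_noHeads (n : ℕ) {q : ℝ} (h1 : q ≤ 1) : 1 - n * q ≤ noHeads n q := by
  have := one_add_mul_le_pow (by linarith : -2 ≤ -q) n
  rw [noHeads, sub_eq_add_neg 1 q]
  linarith

/-- When the estimate is much too low, most slots are noisy. -/
theorem two_mul_noHeads_add_oneHead_le {n : ℕ} {q : ℝ} (h0 : 0 ≤ q) (hq : q ≤ 1 / 4)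
    (hn : 4 ≤ n * q) : 2 * noHeads n q + oneHead n q ≤ 172 / 1000 := by
  rcases n with _ | k
  · norm_num at hn
  simp only [noHeads, oneHead, Nat.add_sub_cancel, pow_succ]
  push_cast at hn ⊢
  have hk : 15 / 4 ≤ k * q := by linarith
  have h1 : (1 - q) ^ k ≤ Real.exp (-(k * q)) := noHeads_le_exp k (by linarith)
  have h2 : 2 * ((1 - q) ^ k * (1 - q)) + (k + 1) * q * (1 - q) ^ k =
      (1 - q) ^ k * (2 + k * q - q) := by ring
  have h3 : (1 - q) ^ k * (2 + k * q - q) ≤ Real.exp (-(k * q)) * (2 + k * q) :=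
    mul_le_mul h1 (by linarith) (by linarith) (Real.exp_pos _).le
  -- Splitting off the least value `15 / 4 = 3 + 3 / 4` of `k * q` leaves a linear lower bound for
  -- the exponential, sharp enough for 172/1000.
  have h4 : Real.exp (k * q) = Real.exp 1 ^ 3 * (Real.exp (3 / 4) * Real.exp (k * q - 15 / 4)) := by
    rw [← Real.exp_nat_mul, ← Real.exp_add, ← Real.exp_add]
    congr 1
    push_cast
    ring
  have h5 := Real.add_one_le_exp (3 / 4)
  have h6 := Real.add_one_le_exp (k * q - 15 / 4)
  have h7 : (2.7 : ℝ) ^ 3 ≤ Real.exp 1 ^ 3 :=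
    pow_le_pow_left₀ (by norm_num) (by linarith [Real.exp_one_gt_d9]) 3
  have h8 : (2.7 : ℝ) ^ 3 * ((3 / 4 + 1) * (k * q - 15 / 4 + 1)) ≤ Real.exp (k * q) := by
    rw [h4]
    refine mul_le_mul h7 (mul_le_mul h5 h6 (by linarith) (Real.exp_pos _).le) ?_ (by positivity)
    exact mul_nonneg (by norm_num) (by linarith)
  rw [h2]
  refine h3.trans ?_
  rw [Real.exp_neg, inv_mul_le_iff₀ (Real.exp_pos _)]
  norm_num at h8
  linarith

/-- The slopes of `potential` are tuned to the two tight cases. For `d < 0` the drift is `-1/2 + 5/2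
* (2 * noHeads + oneHead)`, at most `-7/100` by the bound 172/1000. For `d = 0` it is `-1 + 5/2 *
noHeads`, where `noHeads ≤ 1 / 2.7`. For `d > 0`, noise is rare enough to leave ample room. -/
theorem expected_step_le {n : ℕ} (hn : 2 ≤ n) (d : ℤ) {q : ℝ}
    (hq : q = min (1 / (4 : ℝ) ^ (Nat.log 4 n + d)) 1) :
    noHeads n q * (cost d + potential (d - 1) - potential d) + oneHead n q * cost d +
      manyHeads n q * (cost d + potential (d + 1) - potential d) ≤ -(7 / 100) := by
  have h4 : (0 : ℝ) < 4 ^ (Nat.log 4 n + d) := by positivity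
  have hq0 : 0 ≤ q := hq ▸ le_min (by positivity) zero_le_one
  have hq1 : q ≤ 1 := hq ▸ min_le_right _ _
  have hlo : (4 : ℝ) ^ Nat.log 4 n ≤ n := by
    exact_mod_cast Nat.pow_log_le_self 4 (by omega : n ≠ 0)
  have hhi : (n : ℝ) ≤ 4 ^ (Nat.log 4 n + 1) := by
    exact_mod_cast (Nat.lt_pow_succ_log_self (by norm_num : 1 < 4) n).le
  have hsum : noHeads n q + oneHead n q + manyHeads n q = 1 := by rw [manyHeads]; ring
  have hmany := (manyHeads_mem n hq0 hq1).2
  have hnone := one_sub_le_noHeads n hq1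
  have hle (k : ℕ) (hk : k + 1 ≤ d) : n * q ≤ 1 / 4 ^ k := by
    have h1 : q ≤ 1 / (4 : ℝ) ^ (Nat.log 4 n + d) := hq ▸ min_le_left _ _
    have h2 : (4 : ℝ) ^ (Nat.log 4 n + 1) * 4 ^ k ≤ 4 ^ (Nat.log 4 n + d) := by
      rw [← pow_add, ← zpow_natCast]
      exact zpow_le_zpow_right₀ (by norm_num) (by push_cast; omega)
    rw [le_div_iff₀ h4] at h1
    rw [le_div_iff₀ (by positivity)]
    calc n * q * 4 ^ k ≤ 4 ^ (Nat.log 4 n + 1) * q * 4 ^ k := by gcongr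
      _ = q * (4 ^ (Nat.log 4 n + 1) * 4 ^ k) := by ring
      _ ≤ q * 4 ^ (Nat.log 4 n + d) := by gcongr
      _ ≤ 1 := h1
  rcases (by omega : d ≤ -1 ∨ d = 0 ∨ d = 1 ∨ d = 2 ∨ 3 ≤ d) with h | rfl | rfl | rfl | h
  · have key : 2 * noHeads n q + oneHead n q ≤ 172 / 1000 := by
      -- Estimates of at most 1 have bias capped at 1: all nodes broadcast, and noise is certain.
      rcases le_or_gt ((Nat.log 4 n : ℤ) + d) 0 with hj | hj
      · have h1 : (4 : ℝ) ^ (Nat.log 4 n + d) ≤ 1 := zpow_le_one_of_nonpos₀ (by norm_num) hj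
        have h2 : q = 1 := by
          rw [hq]
          exact min_eq_right ((one_le_div h4).2 h1)
        rw [h2, noHeads, oneHead, sub_self, zero_pow (by omega), zero_pow (by omega)]
        norm_num
      · have h1 : (4 : ℝ) ^ (1 : ℤ) ≤ 4 ^ (Nat.log 4 n + d) :=
          zpow_le_zpow_right₀ (by norm_num) (by omega)
        rw [zpow_one] at h1
        have h2 : q = 1 / (4 : ℝ) ^ (Nat.log 4 n + d) := by
          rw [hq]
          exact min_eq_left ((div_le_one h4).2 (by linarith))
        refine two_mul_noHeads_add_oneHead_le hq0 ?_ ?_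
        · rw [h2]
          exact one_div_le_one_div_of_le (by norm_num) h1
        · rw [h2, mul_one_div, le_div_iff₀ h4]
          refine le_trans ?_ hlo
          rw [← zpow_natCast, ← zpow_one_add₀ (by norm_num)]
          exact zpow_le_zpow_right₀ (by norm_num) (by omega)
    rw [cost_of_bad (by omega), potential_of_nonpos (by omega : d - 1 ≤ 0),
      potential_of_nonpos (by omega : d ≤ 0), potential_of_nonpos (by omega : d + 1 ≤ 0)]
    push_cast
    linarith
  · have h1 : 1 ≤ n * q := by
      have : q = 1 / (4 : ℝ) ^ Nat.log 4 n := by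
        rw [hq, add_zero, zpow_natCast]
        exact min_eq_left ((div_le_one (by positivity)).2 (one_le_pow₀ (by norm_num)))
      rw [this, mul_one_div]
      exact (one_le_div (by positivity)).2 hlo
    have h2 : noHeads n q ≤ 1 / 2.7 := by
      refine (noHeads_le_exp n hq1).trans ((Real.exp_le_exp.2 (neg_le_neg h1)).trans ?_)
      rw [Real.exp_neg, ← one_div]
      exact one_div_le_one_div_of_le (by norm_num) (by linarith [Real.exp_one_gt_d9])
    norm_num [cost, potential] at h2 ⊢
    linarith
  · have h1 := hle 0 (by norm_num)
    have h2 : (n * q) ^ 2 ≤ 1 := by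
      norm_num at h1
      exact pow_le_one₀ (by positivity) h1
    norm_num [cost, potential]
    linarith
  · have h1 := hle 1 (by norm_num)
    have h2 : (n * q) ^ 2 ≤ (1 / 4) ^ 2 := by
      norm_num at h1
      exact pow_le_pow_left₀ (by positivity) h1 2
    norm_num [cost, potential] at h1 h2 ⊢
    linarith
  · have h1 := hle 2 (by omega)
    have h2 : (n * q) ^ 2 ≤ (1 / 16) ^ 2 := by
      norm_num at h1
      exact pow_le_pow_left₀ (by positivity) h1 2
    rw [cost_of_bad (by omega), potential_of_two_le (by omega : 2 ≤ d - 1),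
      potential_of_two_le (by omega : 2 ≤ d), potential_of_two_le (by omega : 2 ≤ d + 1)]
    push_cast
    norm_num at h1 h2
    linarith

/-- If `j` is a mode, then its count is at least those of `m` and `m + 1`, so the left side is
nonnegative. The value `m + 2` is free: it need not be visited often, but is harmless as a mode. -/
theorem two_mul_count_le_sum_cost (m j : ℤ) (hj : j ≠ m ∧ j ≠ m + 1 ∧ j ≠ m + 2) (l : List ℤ) :
    2 * (l.count j : ℝ) - l.count m - l.count (m + 1) ≤ (l.map fun i => cost (i - m)).sum := by
  induction l with
  | nil => simp
  | cons i l ih =>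
    have key : 2 * (if i = j then 1 else 0 : ℝ) - (if i = m then 1 else 0) -
        (if i = m + 1 then 1 else 0) ≤ cost (i - m) := by
      by_cases h0 : i = m
      · subst h0
        rw [if_neg (by omega), if_pos rfl, if_neg (by omega)]
        norm_num [cost]
      · by_cases h1 : i = m + 1
        · subst h1
          rw [if_neg (by omega), if_neg (by omega), if_pos rfl]
          norm_num [cost]
        · by_cases h2 : i = m + 2
          · subst h2
            rw [if_neg (by omega), if_neg (by omega), if_neg (by omega)]
            norm_num [cost]
          · rw [cost_of_bad (by omega), if_neg h0, if_neg h1]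
            split_ifs <;> norm_num
    simp only [List.count_cons, List.map_cons, List.sum_cons, beq_iff_eq]
    push_cast
    linarith

/-- If the visited powers of four have negative total cost, then the most frequent one is close to
the number of nodes. -/
theorem mode_mem_of_sum_cost_neg {mode : List ℚ≥0 → ℚ≥0} (hmode : IsMostFrequent mode) (m : ℤ)
    (l : List ℤ) (hl : l ≠ []) (h : (l.map fun i => cost (i - m)).sum < 0) :
    ∃ j, (j = m ∨ j = m + 1 ∨ j = m + 2) ∧ mode (l.map fun i => (4 : ℚ≥0) ^ i) = 4 ^ j := by
  obtain ⟨hmem, hcount⟩ := hmode (l.map fun i => (4 : ℚ≥0) ^ i) (by simpa using hl)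
  obtain ⟨j, -, hj⟩ := List.mem_map.1 hmem
  have hinj : Function.Injective fun i : ℤ => (4 : ℚ≥0) ^ i :=
    zpow_right_injective₀ (by norm_num) (by norm_num)
  refine ⟨j, ?_, hj.symm⟩
  by_contra hne
  have h1 := two_mul_count_le_sum_cost m j (by omega) l
  have h2 (i : ℤ) : (l.count i : ℝ) ≤ l.count j := by
    have := hcount (4 ^ i)
    rw [← hj, List.count_map_of_injective l (fun i : ℤ => (4 : ℚ≥0) ^ i) hinj,
      List.count_map_of_injective l (fun i : ℤ => (4 : ℚ≥0) ^ i) hinj] at this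
    exact_mod_cast this
  linarith [h2 m, h2 (m + 1)]

theorem sum_map_concat (m j : ℤ) (js : List ℤ) :
    ((js ++ [j]).map fun i => cost (i - m)).sum =
      (js.map fun i => cost (i - m)).sum + cost (j - m) := by simp

/-- The configurations in which all nodes have terminated with a common accurate estimate. -/
def accurate (V : Type*) [Fintype V] : Set (V → State) :=
  {cfg | ∃ e : ℚ≥0, (Fintype.card V : ℚ≥0) ≤ e ∧ e ≤ 64 * (Fintype.card V : ℚ≥0) ∧
    ∀ u : V, (cfg u).output = some e}

theorem done_mem_accurate {V : Type*} [Fintype V] (hV : 2 ≤ Fintype.card V) {j : ℤ}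
    (hj : j = Nat.log 4 (Fintype.card V) ∨ j = Nat.log 4 (Fintype.card V) + 1 ∨
      j = Nat.log 4 (Fintype.card V) + 2) :
    (fun _ => .done (4 * 4 ^ j)) ∈ accurate V := by
  have hlo : (4 : ℚ≥0) ^ (Nat.log 4 (Fintype.card V) : ℤ) ≤ Fintype.card V := by
    rw [zpow_natCast]
    exact_mod_cast Nat.pow_log_le_self 4 (by omega : Fintype.card V ≠ 0)
  have hhi : (Fintype.card V : ℚ≥0) ≤ 4 * 4 ^ (Nat.log 4 (Fintype.card V) : ℤ) := by
    rw [zpow_natCast, ← pow_succ']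
    exact_mod_cast (Nat.lt_pow_succ_log_self (by norm_num : 1 < 4) (Fintype.card V)).le
  have h1 : (4 : ℚ≥0) ^ (Nat.log 4 (Fintype.card V) : ℤ) ≤ 4 ^ j :=
    zpow_le_zpow_right₀ (by norm_num) (by omega)
  have h2 : (4 : ℚ≥0) ^ j ≤ 4 ^ ((Nat.log 4 (Fintype.card V) : ℤ) + 2) :=
    zpow_le_zpow_right₀ (by norm_num) (by omega)
  rw [zpow_add₀ (by norm_num)] at h2
  refine ⟨4 * 4 ^ j, hhi.trans (by gcongr), ?_, fun u => rfl⟩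
  calc 4 * (4 : ℚ≥0) ^ j
      ≤ 4 * (4 ^ (Nat.log 4 (Fintype.card V) : ℤ) * 4 ^ (2 : ℤ)) := by gcongr
    _ ≤ 4 * (Fintype.card V * 4 ^ (2 : ℤ)) := by gcongr
    _ = 64 * Fintype.card V := by
      rw [show (4 : ℚ≥0) ^ (2 : ℤ) = 16 by norm_num]
      ring

variable {V : Type*} [Fintype V] [DecidableEq V] (a : ℕ) {mode : List ℚ≥0 → ℚ≥0}

/-- The inductive step of the exponential Markov bound: `k` counts the iterations still to come
after the present one, and averaging over its outcome gains one factor `1 - 1 / 25000`. -/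
theorem prob_walk_step (hV : 2 ≤ Fintype.card V) (S : Set (V → State)) (L k t : ℕ)
    (js : List ℤ) (j : ℤ)
    (h : ∀ j' : ℤ, 1 - (1 - 1 / 25000 : ℝ) ^ k *
        Real.exp ((((js ++ [j]).map fun i => cost (i - Nat.log 4 (Fintype.card V))).sum +
          potential (j' - Nat.log 4 (Fintype.card V))) / 1000) ≤
      prob a mode S (endIteration a mode L (js.map fun i => (4 : ℚ≥0) ^ i) (4 ^ j) (4 ^ j')) t) :
    1 - (1 - 1 / 25000 : ℝ) ^ (k + 1) *
        Real.exp (((js.map fun i => cost (i - Nat.log 4 (Fintype.card V))).sum +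
          potential (j - Nat.log 4 (Fintype.card V))) / 1000) ≤
      prob a mode S (.walk₁ L (js.map fun i => (4 : ℚ≥0) ^ i) (4 ^ j)) (t + 3) := by
  set m : ℤ := (Nat.log 4 (Fintype.card V) : ℤ) with hm
  set n := Fintype.card V
  set G := (js.map fun i => cost (i - m)).sum
  have hup : 4 * (4 : ℚ≥0) ^ j = 4 ^ (j + 1) := by
    rw [zpow_add_one₀ (by norm_num), mul_comm]
  have hdown : (4 : ℚ≥0) ^ j / 4 = 4 ^ (j - 1) := by
    rw [zpow_sub_one₀ (by norm_num), div_eq_mul_inv]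
  rw [prob_walk a mode hV, hup, hdown]
  set q : ℝ := ((min (1 / ((4 ^ j : ℚ≥0) : ℝ≥0)) 1 : ℝ≥0) : ℝ) with hq
  have hq' : q = min (1 / (4 : ℝ) ^ (m + (j - m))) 1 := by
    rw [hq, add_sub_cancel]
    push_cast
    rfl
  have hq0 : 0 ≤ q := NNReal.coe_nonneg _
  have hq1 : q ≤ 1 := hq' ▸ min_le_right _ _
  have hstep := expected_step_le hV (j - m) hq'
  have hsum : noHeads n q + oneHead n q + manyHeads n q = 1 := by rw [manyHeads]; ring
  have hn0 := noHeads_nonneg n hq1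
  have hn1 := oneHead_nonneg n hq0 hq1
  have hn2 := (manyHeads_mem n hq0 hq1).1
  -- The middle increment keeps its cancelling potentials so that all three outcomes have the shape
  -- that `split` factors out below.
  have hexp := exp_three_step (y := cost (j - m) + potential (j - m) - potential (j - m))
    hn0 hn1 hn2 hsum
    (abs_step_le (j - m) (j - m - 1) (Or.inl rfl))
    (abs_step_le (j - m) (j - m) (Or.inr (Or.inl rfl)))
    (abs_step_le (j - m) (j - m + 1) (Or.inr (Or.inr rfl)))
    (by rw [add_sub_cancel_right]; exact hstep)
  have e0 := mul_le_mul_of_nonneg_left (h (j - 1)) hn0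
  have e1 := mul_le_mul_of_nonneg_left (h j) hn1
  have e2 := mul_le_mul_of_nonneg_left (h (j + 1)) hn2
  refine le_trans ?_ (add_le_add (add_le_add e0 e1) e2)
  rw [sum_map_concat]
  have split (d' : ℤ) : Real.exp ((G + cost (j - m) + potential d') / 1000) =
      Real.exp ((G + potential (j - m)) / 1000) *
        Real.exp ((cost (j - m) + potential d' - potential (j - m)) / 1000) := by
    rw [← Real.exp_add]
    congr 1
    ring
  rw [show j - 1 - m = j - m - 1 by ring, show j + 1 - m = j - m + 1 by ring, split, split, split,
    pow_succ]
  have hE : 0 ≤ (1 - 1 / 25000 : ℝ) ^ k * Real.exp ((G + potential (j - m)) / 1000) :=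
    mul_nonneg (pow_nonneg (by norm_num) _) (Real.exp_pos _).le
  have := mul_le_mul_of_nonneg_left hexp hE
  linarith

/-- At the end, negative total cost means certain success; otherwise the exponential is at least 1
since `potential` is nonnegative, and the bound is trivial. -/
theorem prob_endIteration_ge (hmode : IsMostFrequent mode) (hV : 2 ≤ Fintype.card V) (L k : ℕ) :
    ∀ (t : ℕ) (js : List ℤ) (j j' : ℤ), a * L = js.length + 1 + k → 3 * k ≤ t →
      1 - (1 - 1 / 25000 : ℝ) ^ k *
        Real.exp ((((js ++ [j]).map fun i => cost (i - Nat.log 4 (Fintype.card V))).sum +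
          potential (j' - Nat.log 4 (Fintype.card V))) / 1000) ≤
      prob a mode (accurate V)
        (endIteration a mode L (js.map fun i => (4 : ℚ≥0) ^ i) (4 ^ j) (4 ^ j')) t := by
  induction k with
  | zero =>
    intro t js j j' hk _
    rw [endIteration, if_pos (by rw [List.length_map]; omega)]
    have hl : (js.map fun i => (4 : ℚ≥0) ^ i) ++ [4 ^ j] =
        (js ++ [j]).map fun i => (4 : ℚ≥0) ^ i := by simp
    rw [hl]
    have hp := potential_nonneg (j' - Nat.log 4 (Fintype.card V))
    rcases lt_or_ge (((js ++ [j]).map fun i => cost (i - Nat.log 4 (Fintype.card V))).sum) 0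
      with h | h
    · obtain ⟨i, hi, hi'⟩ := mode_mem_of_sum_cost_neg hmode _ _ (by simp) h
      rw [hi', prob_done a mode _ _ (done_mem_accurate hV hi)]
      linarith [Real.exp_pos ((((js ++ [j]).map fun i =>
        cost (i - Nat.log 4 (Fintype.card V))).sum +
          potential (j' - Nat.log 4 (Fintype.card V))) / 1000)]
    · refine le_trans ?_ (prob_nonneg _ _ _ _ _)
      have := Real.one_le_exp (div_nonneg (add_nonneg h hp) (by norm_num : (0 : ℝ) ≤ 1000))
      linarith
  | succ k ih =>
    intro t js j j' hk ht
    rw [endIteration, if_neg (by rw [List.length_map]; omega)]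
    have hl : (js.map fun i => (4 : ℚ≥0) ^ i) ++ [4 ^ j] =
        (js ++ [j]).map fun i => (4 : ℚ≥0) ^ i := by simp
    obtain ⟨t, rfl⟩ := Nat.exists_eq_add_of_le' (by omega : 3 ≤ t)
    rw [hl]
    exact prob_walk_step a hV _ L k t _ j' fun j'' =>
      ih t _ j' j'' (by rw [List.length_append, List.length_singleton]; omega) (by omega)

/-- The success probability of the walk. -/
theorem prob_walk_ge (hmode : IsMostFrequent mode) (hV : 2 ≤ Fintype.card V) (L t : ℕ)
    (haL : 0 < a * L) (ht : 3 * (a * L) ≤ t) (j : ℤ) :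
    1 - (1 - 1 / 25000 : ℝ) ^ (a * L) *
        Real.exp (potential (j - Nat.log 4 (Fintype.card V)) / 1000) ≤
      prob a mode (accurate V) (.walk₁ L [] (4 ^ j)) t := by
  obtain ⟨k, hk⟩ := Nat.exists_eq_add_of_lt haL
  obtain ⟨t, rfl⟩ := Nat.exists_eq_add_of_le' (by omega : 3 ≤ t)
  have := prob_walk_step (mode := mode) a hV (accurate V) L k t [] j fun j' =>
    prob_endIteration_ge a hmode hV L k t [] j j' (by simp; omega) (by omega)
  simpa [hk] using this

theorem prob_endIteration_terminated (mode : List ℚ≥0 → ℚ≥0) (hV : 2 ≤ Fintype.card V) (L k : ℕ) :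
    ∀ (t : ℕ) (used : List ℚ≥0) (e e' : ℚ≥0), a * L ≤ used.length + 1 + k → 3 * k ≤ t →
      prob a mode {cfg : V → State | ∀ u, (cfg u).output.isSome}
        (endIteration a mode L used e e') t = 1 := by
  induction k with
  | zero =>
    intro t used e e' hk _
    rw [endIteration, if_pos hk]
    exact prob_done a mode _ _ (by simp [State.output]) t
  | succ k ih =>
    intro t used e e' hk ht
    rw [endIteration]
    split_ifs
    · exact prob_done a mode _ _ (by simp [State.output]) t
    · obtain ⟨t, rfl⟩ := Nat.exists_eq_add_of_le' (by omega : 3 ≤ t)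
      have hl : a * L ≤ (used ++ [e]).length + 1 + k := by
        rw [List.length_append, List.length_singleton]; omega
      rw [prob_walk a mode hV, ih t _ _ _ hl (by omega), ih t _ _ _ hl (by omega),
        ih t _ _ _ hl (by omega), manyHeads]
      ring

theorem prob_walk_terminated (mode : List ℚ≥0 → ℚ≥0) (hV : 2 ≤ Fintype.card V) (L t : ℕ)
    (haL : 0 < a * L) (ht : 3 * (a * L) ≤ t) (e : ℚ≥0) :
    prob a mode {cfg : V → State | ∀ u, (cfg u).output.isSome} (.walk₁ L [] e) t = 1 := by
  obtain ⟨k, hk⟩ := Nat.exists_eq_add_of_lt haL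
  obtain ⟨t, rfl⟩ := Nat.exists_eq_add_of_le' (by omega : 3 ≤ t)
  have hl : a * L ≤ ([] : List ℚ≥0).length + 1 + k := by simp; omega
  rw [prob_walk a mode hV, prob_endIteration_terminated a mode hV L k t _ _ _ hl (by omega),
    prob_endIteration_terminated a mode hV L k t _ _ _ hl (by omega),
    prob_endIteration_terminated a mode hV L k t _ _ _ hl (by omega), manyHeads]
  ring

end Walk

/-! ### The search for an upper bound, and the total failure probability. -/

section Search

/-- The probability that at least two of `n` nodes broadcast in iteration `i` of the search. -/
noncomputable def searchNoise (n i : ℕ) : ℝ := manyHeads n (1 / 2 ^ 2 ^ i)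

theorem one_div_two_pow_mem (i : ℕ) : (0 : ℝ) ≤ 1 / 2 ^ 2 ^ i ∧ (1 : ℝ) / 2 ^ 2 ^ i ≤ 1 :=
  ⟨by positivity, (div_le_one (by positivity)).2 (one_le_pow₀ (by norm_num))⟩

theorem searchNoise_nonneg (n i : ℕ) : 0 ≤ searchNoise n i :=
  (manyHeads_mem n (one_div_two_pow_mem i).1 (one_div_two_pow_mem i).2).1

theorem searchNoise_le (n i : ℕ) : searchNoise n i ≤ (n / 2 ^ 2 ^ i) ^ 2 / 2 := by
  have := (manyHeads_mem n (one_div_two_pow_mem i).1 (one_div_two_pow_mem i).2).2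
  rwa [mul_one_div] at this

theorem searchNoise_le_one (n i : ℕ) : searchNoise n i ≤ 1 := by
  have h := one_div_two_pow_mem i
  have h0 := noHeads_nonneg n h.2
  have h1 := oneHead_nonneg n h.1 h.2
  rw [searchNoise, manyHeads]
  linarith

/-- The search rarely ends while its upper bound is much too low. -/
theorem one_sub_searchNoise_le {n i : ℕ} (hi : 1 ≤ i) (h : (2 ^ 2 ^ i) ^ 8 ≤ n) :
    1 - searchNoise n i ≤ 1 / (4 * (n : ℝ) ^ 2) := by
  set M : ℝ := 2 ^ 2 ^ i with hM
  have hM4 : 4 ≤ M := by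
    have : (2 : ℝ) ^ 2 ≤ 2 ^ 2 ^ i :=
      pow_le_pow_right₀ (by norm_num) (by simpa using pow_le_pow_right₀ one_le_two hi)
    linarith
  have hn : M ^ 8 ≤ n := by rw [hM]; exact_mod_cast h
  obtain ⟨k, rfl⟩ : ∃ k, n = k + 1 := Nat.exists_eq_add_one.2 (by
    have : 0 < (2 ^ 2 ^ i) ^ 8 := by positivity
    omega)
  have hq := one_div_two_pow_mem i
  set q : ℝ := 1 / M with hqM
  set x : ℝ := (k + 1 : ℕ) * q with hx
  have hxM : x = ((k + 1 : ℕ) : ℝ) / M := mul_one_div _ _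
  have hx14 : 2 ^ 14 ≤ x := by
    rw [hxM, le_div_iff₀ (by positivity)]
    calc (2 : ℝ) ^ 14 * M = 4 ^ 7 * M := by norm_num
      _ ≤ M ^ 7 * M := by gcongr
      _ = M ^ 8 := by ring
      _ ≤ _ := hn
  -- With `n` polynomial in the expected number `x` of broadcasters, a tail exponentially small in
  -- `x` beats `n ^ 2`.
  have hnx : ((k + 1 : ℕ) : ℝ) ≤ x ^ 2 := by
    rw [hxM, div_pow, le_div_iff₀ (by positivity), sq ((k + 1 : ℕ) : ℝ)]
    have : M ^ 2 ≤ ((k + 1 : ℕ) : ℝ) :=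
      (pow_le_pow_right₀ (by linarith) (by norm_num)).trans hn
    exact mul_le_mul_of_nonneg_left this (Nat.cast_nonneg _)
  have hxy : x = k * q + q := by rw [hx]; push_cast; ring
  set y : ℝ := k * q with hy
  have hq1 : q ≤ 1 := hq.2
  have hxy2 : x ≤ 2 * y := by norm_num at hx14; linarith
  have hy13 : 2 ^ 13 ≤ y := by norm_num at hx14 ⊢; linarith
  have e1 : 1 - searchNoise (k + 1) i = (1 - q) ^ k * (1 + y) := by
    simp only [searchNoise, manyHeads, noHeads, oneHead, Nat.add_sub_cancel, pow_succ]
    rw [← hM, ← hqM, hy]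
    push_cast
    ring
  have e2 : (1 - q) ^ k ≤ Real.exp (-y) := noHeads_le_exp k hq1
  have hy0 : 0 < y := lt_of_lt_of_le (by norm_num) hy13
  -- Degree 8 beats the degree 5 of `(1 + y) * 4 * n ^ 2`; the spare `y ^ 3 ≥ 2 ^ 39` absorbs the
  -- constant `2 ^ 7 * 8 ^ 8 = 2 ^ 31`.
  have e3 : (y / 8) ^ 8 ≤ Real.exp y := by
    have h1 : y / 8 ≤ Real.exp (y / 8) := by linarith [Real.add_one_le_exp (y / 8)]
    have h2 := pow_le_pow_left₀ (by positivity) h1 8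
    rw [← Real.exp_nat_mul] at h2
    rwa [Nat.cast_ofNat, mul_div_cancel₀ y (by norm_num : (8 : ℝ) ≠ 0)] at h2
  have e4 : (1 + y) * (4 * ((k + 1 : ℕ) : ℝ) ^ 2) ≤ Real.exp y := by
    calc (1 + y) * (4 * ((k + 1 : ℕ) : ℝ) ^ 2) ≤ (2 * y) * (4 * (((2 * y) ^ 2) ^ 2)) := by
          have h0 : 0 ≤ x := by linarith [hxy, hq.1]
          have h1 : ((k + 1 : ℕ) : ℝ) ≤ (2 * y) ^ 2 :=
            hnx.trans (pow_le_pow_left₀ h0 hxy2 2)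
          have h2 : 1 + y ≤ 2 * y := by norm_num at hy13; linarith
          gcongr
      _ = y ^ 5 * 2 ^ 7 := by ring
      _ ≤ y ^ 5 * (y ^ 3 / 8 ^ 8) := by
          have := pow_le_pow_left₀ (by norm_num) hy13 3
          gcongr
          rw [le_div_iff₀ (by norm_num)]
          exact le_trans (by norm_num) this
      _ = (y / 8) ^ 8 := by ring
      _ ≤ Real.exp y := e3
  rw [e1, le_div_iff₀ (by positivity)]
  calc (1 - q) ^ k * (1 + y) * (4 * ((k + 1 : ℕ) : ℝ) ^ 2)
      ≤ Real.exp (-y) * (1 + y) * (4 * ((k + 1 : ℕ) : ℝ) ^ 2) := by gcongr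
    _ = Real.exp (-y) * ((1 + y) * (4 * ((k + 1 : ℕ) : ℝ) ^ 2)) := by ring
    _ ≤ Real.exp (-y) * Real.exp y := by gcongr
    _ = 1 := by rw [← Real.exp_add, neg_add_cancel, Real.exp_zero]

variable {V : Type*} [Fintype V] [DecidableEq V] (a : ℕ) (mode : List ℚ≥0 → ℚ≥0)

theorem prob_search_eq (hV : 2 ≤ Fintype.card V) (S : Set (V → State)) (i t : ℕ) :
    prob a mode S (.search i) (t + 2) =
      (1 - searchNoise (Fintype.card V) i) *
        prob a mode S (.walk₁ (2 ^ (i + 1)) [] (2 ^ 2 ^ (i + 1))) t +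
      searchNoise (Fintype.card V) i * prob a mode S (.search (i + 1)) t := by
  have h : ((min (1 / 2 ^ 2 ^ i) 1 : ℝ≥0) : ℝ) = 1 / 2 ^ 2 ^ i := by
    push_cast
    exact min_eq_left (one_div_two_pow_mem i).2
  rw [prob_search a mode hV, h, searchNoise]

/-- Here `ω i` bounds the failure of the walk started after iteration `i`. The part `ε` is weighted
by the stopping probabilities, so it is paid once in total; `δ` is paid in each iteration, for stops
that are improbable but ruinous; `η` pays for searching beyond iteration `I`. -/
theorem prob_search_ge (hV : 2 ≤ Fintype.card V) (S : Set (V → State)) (I T : ℕ) (ω : ℕ → ℝ)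
    {ε δ η : ℝ} (hε : 0 ≤ ε) (hδ : 0 ≤ δ) (hη : 0 ≤ η)
    (hwalk : ∀ i, 1 ≤ i → i ≤ I → ∀ t, T ≤ t →
      1 - ω i ≤ prob a mode S (.walk₁ (2 ^ (i + 1)) [] (2 ^ 2 ^ (i + 1))) t)
    (hω : ∀ i, 1 ≤ i → i ≤ I → (1 - searchNoise (Fintype.card V) i) * ω i ≤
      ε * (1 - searchNoise (Fintype.card V) i) + δ)
    (hI : searchNoise (Fintype.card V) I ≤ η) (k : ℕ) :
    ∀ i t, 1 ≤ i → i + k = I → 2 * (k + 1) + T ≤ t →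
      1 - ε - (k + 1) * δ - η ≤ prob a mode S (.search i) t := by
  induction k with
  | zero =>
    rintro i t hi rfl ht
    obtain ⟨t, rfl⟩ := Nat.exists_eq_add_of_le' (by omega : 2 ≤ t)
    rw [prob_search_eq a mode hV]
    have h0 := searchNoise_nonneg (Fintype.card V) i
    have h1 := searchNoise_le_one (Fintype.card V) i
    have h2 := mul_le_mul_of_nonneg_left (hwalk i hi le_rfl t (by omega)) (sub_nonneg.2 h1)
    have h3 := mul_nonneg h0 (prob_nonneg a mode S (.search (i + 1)) t)
    have h4 := hω i hi le_rfl
    have h5 := mul_nonneg hε h0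
    rw [add_zero] at hI
    push_cast
    linarith
  | succ k ih =>
    rintro i t hi hk ht
    obtain ⟨t, rfl⟩ := Nat.exists_eq_add_of_le' (by omega : 2 ≤ t)
    rw [prob_search_eq a mode hV]
    have h0 := searchNoise_nonneg (Fintype.card V) i
    have h1 := searchNoise_le_one (Fintype.card V) i
    have h2 := mul_le_mul_of_nonneg_left (hwalk i hi (by omega) t (by omega)) (sub_nonneg.2 h1)
    have h3 := mul_le_mul_of_nonneg_left (ih (i + 1) t (by omega) (by omega) (by omega)) h0
    have h4 := hω i hi (by omega)
    have h5 : searchNoise (Fintype.card V) i * ((k + 1) * δ + η) ≤ (k + 1) * δ + η :=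
      mul_le_of_le_one_left (by positivity) h1
    push_cast
    linarith

theorem prob_search_one (S : Set (V → State)) (t : ℕ) :
    prob a mode S (.search 1) t =
      (((countSHCDHigh a mode).run (⊤ : SimpleGraph V) t).toOuterMeasure S).toReal := by
  rw [Protocol.run_eq_runFrom]
  rfl

theorem mul_two_pow_le {i I : ℕ} (h : i ≤ I) : a * 2 ^ (i + 1) ≤ a * 2 ^ (I + 1) :=
  Nat.mul_le_mul_left _ (Nat.pow_le_pow_right (by norm_num) (by omega))

theorem tendsto_terminated (ha : 0 < a) (hV : 2 ≤ Fintype.card V) :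
    Tendsto (fun t : ℕ => ((countSHCDHigh a mode).run (⊤ : SimpleGraph V) t).toOuterMeasure
      {cfg | ∀ u : V, (cfg u).output.isSome}) atTop (𝓝 1) := by
  rw [← ENNReal.tendsto_toReal_iff (fun t => PMF.toOuterMeasure_apply_ne_top _ _)
    ENNReal.one_ne_top, ENNReal.toReal_one]
  simp only [← prob_search_one]
  rw [tendsto_order]
  refine ⟨fun b hb => ?_, fun b hb => .of_forall fun t =>
    (prob_le_one a mode _ _ t).trans_lt hb⟩
  -- A crude choice suffices, because `I ≤ (2 ^ 2 ^ I) ^ 2` makes the noise at iteration `I` less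
  -- than `1 - b`.
  obtain ⟨I, hI⟩ := exists_nat_gt ((Fintype.card V : ℝ) ^ 2 / (1 - b))
  have hb' : 0 < 1 - b := sub_pos.2 hb
  have hI0 : 0 < (I : ℝ) := lt_of_le_of_lt (by positivity) hI
  have hI1 : 0 < I := by exact_mod_cast hI0
  have hnoise : searchNoise (Fintype.card V) I < 1 - b := by
    refine (searchNoise_le _ _).trans_lt ?_
    have h1 : (I : ℝ) ≤ (2 ^ 2 ^ I) ^ 2 := by
      have : I ≤ (2 ^ 2 ^ I) ^ 2 :=
        (Nat.lt_two_pow_self.le.trans Nat.lt_two_pow_self.le).trans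
          (Nat.le_self_pow (by norm_num) _)
      exact_mod_cast this
    rw [div_lt_iff₀ hb'] at hI
    rw [div_pow, div_lt_iff₀ (by norm_num), div_lt_iff₀ (by positivity)]
    have h2 := mul_le_mul_of_nonneg_right h1 hb'.le
    have h3 : 0 ≤ (1 - b) * (2 ^ 2 ^ I) ^ 2 := by positivity
    linarith
  filter_upwards [eventually_ge_atTop (2 * I + 3 * (a * 2 ^ (I + 1)))] with t ht
  obtain ⟨k, rfl⟩ := Nat.exists_eq_add_of_le' hI1
  have := prob_search_ge a mode hV {cfg : V → State | ∀ u, (cfg u).output.isSome} (k + 1)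
    (3 * (a * 2 ^ (k + 1 + 1))) (fun _ => 0) le_rfl le_rfl
    (searchNoise_nonneg (Fintype.card V) (k + 1))
    (fun i _ hi t ht => by
      rw [prob_walk_terminated a mode hV _ t (by positivity)
        ((Nat.mul_le_mul_left 3 (mul_two_pow_le a hi)).trans ht), sub_zero])
    (fun i _ _ => by simp) le_rfl k 1 t le_rfl (add_comm _ _) ht
  linarith

/-- The walk succeeds with high probability from every upper bound that is not much too low. -/
theorem prob_walk_accurate_ge {mode : List ℚ≥0 → ℚ≥0} (hmode : IsMostFrequent mode) (ha : 0 < a)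
    (ha' : (1 - 1 / 25000 : ℝ) ^ a ≤ Real.exp (-(15 / 1000)) / 4 ^ 5)
    (hV : 2 ≤ Fintype.card V) {i : ℕ} (hi : Fintype.card V < (2 ^ 2 ^ i) ^ 8) (t : ℕ)
    (ht : 3 * (a * 2 ^ (i + 1)) ≤ t) :
    1 - 1 / (4 * (Fintype.card V : ℝ)) ≤
      prob a mode (accurate V) (.walk₁ (2 ^ (i + 1)) [] (2 ^ 2 ^ (i + 1))) t := by
  have h4 : (2 : ℚ≥0) ^ 2 ^ (i + 1) = 4 ^ ((2 ^ i : ℕ) : ℤ) := by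
    rw [zpow_natCast, pow_succ', pow_mul]
    norm_num
  have hi' : Fintype.card V < 4 ^ (4 * 2 ^ i) := by
    refine hi.trans_eq ?_
    rw [show 4 = 2 ^ 2 by norm_num, ← pow_mul, ← pow_mul]
    congr 1
    ring
  have hlog : Nat.log 4 (Fintype.card V) < 4 * 2 ^ i := Nat.log_lt_of_lt_pow (by omega) hi'
  rw [h4]
  refine le_trans ?_ (prob_walk_ge a hmode hV (2 ^ (i + 1)) t (by positivity) ht _)
  -- The walk starts at `4 ^ 2 ^ i` and `log₄ n < 4 * 2 ^ i`, so the distance is at most `5 * 2 ^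
  -- i`, and `potential` has slope at most 3.
  have hpot : potential ((2 ^ i : ℕ) - Nat.log 4 (Fintype.card V)) ≤ (2 ^ i : ℕ) * 15 := by
    refine (potential_le _).trans ?_
    have h1 : ((Nat.log 4 (Fintype.card V) : ℕ) : ℝ) ≤ 4 * (2 ^ i : ℕ) := by exact_mod_cast hlog.le
    have h2 : (0 : ℝ) ≤ (2 ^ i : ℕ) := Nat.cast_nonneg _
    have h3 : (0 : ℝ) ≤ (Nat.log 4 (Fintype.card V) : ℕ) := Nat.cast_nonneg _
    have h4 : |(((2 ^ i : ℕ) - Nat.log 4 (Fintype.card V) : ℤ) : ℝ)| ≤ 5 * (2 ^ i : ℕ) := by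
      rw [abs_le, Int.cast_sub, Int.cast_natCast, Int.cast_natCast]
      constructor <;> linarith
    linarith
  set s : ℕ := 2 ^ i with hs
  have hs1 : 1 ≤ s := Nat.one_le_two_pow
  have hcard : 4 * (Fintype.card V : ℝ) ≤ (4 ^ 5) ^ s := by
    have : 4 * Fintype.card V ≤ (4 ^ 5) ^ s := by
      calc 4 * Fintype.card V ≤ 4 * 4 ^ (4 * s) := Nat.mul_le_mul_left 4 hi'.le
        _ = 4 ^ (4 * s + 1) := by rw [pow_succ']
        _ ≤ 4 ^ (5 * s) := Nat.pow_le_pow_right (by norm_num) (by omega)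
        _ = (4 ^ 5) ^ s := by rw [pow_mul]
    exact_mod_cast this
  have hpos : 0 < Fintype.card V := by omega
  refine sub_le_sub_left ?_ 1
  calc (1 - 1 / 25000 : ℝ) ^ (a * 2 ^ (i + 1)) *
        Real.exp (potential (s - Nat.log 4 (Fintype.card V)) / 1000)
      ≤ (1 - 1 / 25000 : ℝ) ^ (a * s) * Real.exp (s * (15 / 1000)) := by
        gcongr ?_ * Real.exp ?_
        · refine pow_le_pow_of_le_one (by norm_num) (by norm_num) ?_
          exact Nat.mul_le_mul_left a (Nat.pow_le_pow_right (by norm_num) (Nat.le_succ i))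
        · linarith
    _ = ((1 - 1 / 25000 : ℝ) ^ a * Real.exp (15 / 1000)) ^ s := by
        rw [mul_pow, pow_mul, Real.exp_nat_mul]
    _ ≤ (1 / 4 ^ 5) ^ s := by
        refine pow_le_pow_left₀ (mul_nonneg (pow_nonneg (by norm_num) _) (Real.exp_pos _).le) ?_ s
        rw [Real.exp_neg, inv_eq_one_div, div_div, le_div_iff₀ (by positivity)] at ha'
        rw [le_div_iff₀ (by norm_num)]
        linarith
    _ = 1 / (4 ^ 5) ^ s := by rw [div_pow, one_pow]
    _ ≤ 1 / (4 * (Fintype.card V : ℝ)) :=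
        one_div_le_one_div_of_le (by positivity) hcard

/-- Iterations of the search suffice to reach an upper bound of at least `n ^ 2`, and the slots
that they take are proportional to `lg n`. -/
theorem exists_search_bound {n : ℕ} (hn : 2 ≤ n) :
    ∃ k : ℕ, k + 1 ≤ n ∧ n ^ 2 ≤ 2 ^ 2 ^ (k + 1) ∧ (2 ^ (k + 1) : ℝ) ≤ 8 * Real.logb 2 n := by
  set l := Nat.clog 2 n with hl
  have hl1 : 0 < l := Nat.clog_pos (by norm_num) hn
  have hle : n ≤ 2 ^ l := Nat.le_pow_clog (by norm_num) n
  have hlt : 2 ^ (l - 1) < n := Nat.pow_pred_clog_lt_self (by norm_num) hn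
  have hI1 : 0 < Nat.clog 2 (2 * l) := Nat.clog_pos (by norm_num) (by omega)
  have hIle : 2 * l ≤ 2 ^ Nat.clog 2 (2 * l) := Nat.le_pow_clog (by norm_num) _
  have hIlt : 2 ^ (Nat.clog 2 (2 * l) - 1) < 2 * l :=
    Nat.pow_pred_clog_lt_self (by norm_num) (by omega)
  obtain ⟨k, hk⟩ := Nat.exists_eq_add_of_le' hI1
  rw [hk] at hIle hIlt
  rw [Nat.add_sub_cancel] at hIlt
  refine ⟨k, ?_, ?_, ?_⟩
  · have h1 : l - 1 < 2 ^ (l - 1) := Nat.lt_two_pow_self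
    rcases k with _ | k
    · omega
    · have h2 : k < 2 ^ k := Nat.lt_two_pow_self
      rw [pow_succ] at hIlt
      omega
  · calc n ^ 2 ≤ (2 ^ l) ^ 2 := Nat.pow_le_pow_left hle 2
      _ = 2 ^ (2 * l) := by rw [← pow_mul, mul_comm]
      _ ≤ 2 ^ 2 ^ (k + 1) := Nat.pow_le_pow_right (by norm_num) hIle
  · have h1 : (1 : ℝ) ≤ Real.logb 2 n := by
      rw [Real.le_logb_iff_rpow_le (by norm_num) (by positivity), Real.rpow_one]
      exact_mod_cast hn
    have h2 : ((l - 1 : ℕ) : ℝ) ≤ Real.logb 2 n := by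
      rw [Real.le_logb_iff_rpow_le (by norm_num) (by positivity), Real.rpow_natCast]
      exact_mod_cast hlt.le
    rw [Nat.cast_sub hl1, Nat.cast_one] at h2
    have h3 : (2 ^ k : ℝ) ≤ 2 * l := by exact_mod_cast hIlt.le
    rw [pow_succ]
    linarith

theorem prob_accurate_ge {mode : List ℚ≥0 → ℚ≥0} (hmode : IsMostFrequent mode) (ha : 0 < a)
    (ha' : (1 - 1 / 25000 : ℝ) ^ a ≤ Real.exp (-(15 / 1000)) / 4 ^ 5)
    (hV : 2 ≤ Fintype.card V) {k : ℕ} (hk : k + 1 ≤ Fintype.card V)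
    (hk' : Fintype.card V ^ 2 ≤ 2 ^ 2 ^ (k + 1)) :
    1 - 1 / (Fintype.card V : ℝ) ≤
      prob a mode (accurate V) (.search 1) (2 * (k + 1) + 3 * (a * 2 ^ (k + 1 + 1))) := by
  set n := Fintype.card V
  have hn : (2 : ℝ) ≤ n := by exact_mod_cast hV
  have hn0 : (0 : ℝ) < n := by linarith
  have hnoise : searchNoise n (k + 1) ≤ 1 / (4 * (n : ℝ)) := by
    refine (searchNoise_le _ _).trans ?_
    have h1 : (n : ℝ) ^ 2 ≤ 2 ^ 2 ^ (k + 1) := by exact_mod_cast hk'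
    have h2 : (n : ℝ) / 2 ^ 2 ^ (k + 1) ≤ 1 / n := by
      rw [div_le_div_iff₀ (by positivity) hn0]
      linarith
    calc ((n : ℝ) / 2 ^ 2 ^ (k + 1)) ^ 2 / (2 : ℝ) ≤ (1 / (n : ℝ)) ^ 2 / (2 : ℝ) := by gcongr
      _ ≤ 1 / (4 * (n : ℝ)) := by
        rw [div_pow, one_pow, div_div, div_le_div_iff₀ (by positivity) (by positivity)]
        nlinarith
  -- When the upper bound is far too low, the walk is given up (`ω = 1`) and the small stopping
  -- probability is charged to `δ`. Summed over the `k + 1 ≤ n` iterations, `δ` costs at most `1 /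
  -- (4 n)`.
  have := prob_search_ge a mode hV (accurate V) (k + 1) (3 * (a * 2 ^ (k + 1 + 1)))
    (fun i => if (2 ^ 2 ^ i) ^ 8 ≤ n then 1 else 1 / (4 * (n : ℝ)))
    (by positivity : 0 ≤ 1 / (4 * (n : ℝ))) (by positivity : 0 ≤ 1 / (4 * (n : ℝ) ^ 2))
    (by positivity : 0 ≤ 1 / (4 * (n : ℝ)))
    (fun i _ hi t ht => by
      split_ifs with h
      · rw [sub_self]
        exact prob_nonneg _ _ _ _ _
      · exact prob_walk_accurate_ge a hmode ha ha' hV (not_le.1 h) t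
          ((Nat.mul_le_mul_left 3 (mul_two_pow_le a hi)).trans ht))
    (fun i hi _ => by
      have h0 : 0 ≤ 1 - searchNoise n i := sub_nonneg.2 (searchNoise_le_one n i)
      split_ifs with h
      · have := one_sub_searchNoise_le hi h
        have h1 : 0 ≤ 1 / (4 * (n : ℝ)) * (1 - searchNoise n i) := by positivity
        linarith
      · have h1 : 0 ≤ 1 / (4 * (n : ℝ) ^ 2) := by positivity
        linarith)
    hnoise k 1 _ le_rfl (add_comm _ _) le_rfl
  refine le_trans ?_ this
  have h1 : ((k : ℝ) + 1) * (1 / (4 * (n : ℝ) ^ 2)) ≤ 1 / (4 * (n : ℝ)) := by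
    have : (k : ℝ) + 1 ≤ n := by exact_mod_cast hk
    rw [mul_one_div, div_le_div_iff₀ (by positivity) (by positivity)]
    nlinarith
  have h2 : 1 / (4 * (n : ℝ)) = 1 / n / 4 := by rw [mul_comm, div_div]
  have h3 : 0 < 1 / (n : ℝ) := by positivity
  linarith

end Search

end CountSHCDHigh

end RadioNetwork

theorem mainTheorem5 :
    ∃ γ : ℝ, 1 ≤ γ ∧ ∃ a₀ : ℕ, ∀ a : ℕ, a₀ ≤ a → ∃ C : ℝ,
      ∀ mode : List ℚ≥0 → ℚ≥0, RadioNetwork.IsMostFrequent mode →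
      ∀ (V : Type*) [Fintype V] [DecidableEq V], 2 ≤ Fintype.card V →
        -- in every execution, in every slot, either all nodes or none have terminated
        (∀ t : ℕ, ∀ cfg ∈ ((RadioNetwork.countSHCDHigh a mode).run (⊤ : SimpleGraph V) t).support,
          ∀ u v : V, (cfg u).output.isSome → (cfg v).output.isSome) ∧
        -- with probability one the nodes do terminate
        Tendsto (fun t : ℕ =>
          ((RadioNetwork.countSHCDHigh a mode).run (⊤ : SimpleGraph V) t).toOuterMeasure
            {cfg | ∀ u : V, (cfg u).output.isSome}) atTop (𝓝 1) ∧
        -- with high probability they have a common, accurate estimate within `C * lg n` slots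
        ∃ t : ℕ, (t : ℝ) ≤ C * Real.logb 2 (Fintype.card V) ∧
          ENNReal.ofReal (1 - 1 / (Fintype.card V : ℝ) ^ γ) ≤
            ((RadioNetwork.countSHCDHigh a mode).run (⊤ : SimpleGraph V) t).toOuterMeasure
              {cfg | ∃ e : ℚ≥0, (Fintype.card V : ℚ≥0) ≤ e ∧ e ≤ 64 * (Fintype.card V : ℚ≥0) ∧
                ∀ u : V, (cfg u).output = some e} := by
  -- The threshold for `a` makes the contraction beat both the initial potential (`15 / 1000` per
  -- unit of `2 ^ i`) and the factor `4 n ≤ (4 ^ 5) ^ 2 ^ i`.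
  obtain ⟨a₁, ha₁⟩ := exists_pow_lt_of_lt_one
    (by positivity : 0 < Real.exp (-(15 / 1000)) / 4 ^ 5) (by norm_num : (1 - 1 / 25000 : ℝ) < 1)
  refine ⟨1, le_rfl, a₁ + 1, fun a ha => ⟨8 * (2 + 6 * a), fun mode hmode V _ _ hV => ?_⟩⟩
  have ha0 : 0 < a := by omega
  have ha' := (pow_le_pow_of_le_one (by norm_num) (by norm_num)
    (by omega : a₁ ≤ a)).trans ha₁.le
  refine ⟨fun t cfg h u v => (RadioNetwork.CountSHCDHigh.inStep_of_mem_support_run a mode hV t cfg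
    h).output_isSome u v, RadioNetwork.CountSHCDHigh.tendsto_terminated a mode ha0 hV, ?_⟩
  obtain ⟨k, hk, hk', hlog⟩ := RadioNetwork.CountSHCDHigh.exists_search_bound hV
  refine ⟨2 * (k + 1) + 3 * (a * 2 ^ (k + 1 + 1)), ?_, ?_⟩
  · have h1 : ((k + 1 : ℕ) : ℝ) ≤ 2 ^ (k + 1) := by exact_mod_cast Nat.lt_two_pow_self.le
    have h2 := mul_le_mul_of_nonneg_left hlog (by positivity : (0 : ℝ) ≤ 2 + 6 * a)
    push_cast at h1 ⊢
    rw [pow_succ (2 : ℝ) (k + 1)]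
    linarith
  · rw [Real.rpow_one]
    refine ENNReal.ofReal_le_of_le_toReal ?_
    exact (RadioNetwork.CountSHCDHigh.prob_accurate_ge a hmode ha0 ha' hV hk hk').trans_eq
      (RadioNetwork.CountSHCDHigh.prob_search_one a mode _ _)
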